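/- Let $\epsilon\in\{1,-1\}$, let $\Sigma_7\subset\mathbb R^7$ be open, and let $\{\omega^i\}_{i=1}^7$ be a smooth coframe on $\Sigma_7$ satisfying the generic hyperbolic structure equations $$\begin{aligned} d\omega^1&\equiv\omega^3\wedge\omega^6+\omega^2\wedge\omega^4 &&\bmod \{\omega^1\},\\ d\omega^2&\equiv\omega^4\wedge\omega^5+\omega^3\wedge\omega^7 &&\bmod \{\omega^1,\omega^2\},\\ d\omega^3&\equiv\omega^6\wedge\omega^7+\epsilon\,\omega^2\wedge\omega^5 &&\bmod \{\omega^1,\omega^3\},\\ d\omega^4&\equiv\epsilon\,\omega^5\wedge\omega^6 &&\bmod \{\omega^1,\omega^2,\omega^4\},\\ d\omega^5&\equiv 0 &&\bmod \{\omega^1,\omega^2,\omega^4,\omega^5\},\\ d\omega^6&\equiv-\omega^4\wedge\omega^7 &&\bmod \{\omega^1,\omega^3,\omega^6\},\\ d\omega^7&\equiv 0 &&\bmod \{\omega^1,\omega^3,\omega^6,\omega^7\}. \end{aligned}$$ Write $d\omega^i=\tfrac12\gamma^i{}_{jk}\,\omega^j\wedge\omega^k$ with $\gamma^i{}_{jk}=-\gamma^i{}_{kj}$.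 Let $K^0=\{\mathrm{diag}(a^2,a,a,a,1,a,1): a>0\}$, with weights $w=(2,1,1,1,0,1,0)$. On $\Sigma_7\times K^0$ the lifted coframe $\hat\omega^i=a^{w_i}\omega^i$ satisfies $d\hat\omega^i=w_i\,\alpha\wedge\hat\omega^i+\tfrac12\hat\gamma^i{}_{jk}\,\hat\omega^j\wedge\hat\omega^k$, where $\alpha=da/a$ and $\hat\gamma^i{}_{jk}=a^{w_i-w_j-w_k}\gamma^i{}_{jk}$. A torsion coefficient (with respect to $K^0$) is a constant-coefficient linear combination $\kappa$ of the $\gamma^i{}_{jk}$ which is unaffected by every substitution $\alpha\mapsto\alpha+\lambda_j\hat\omega^j$ (absorption); it has scaling weight $p$ if $\hat\kappa=a^p\kappa$, and $K^0$ acts on it nontrivially if $p\neq0$. Say that $K^0$ can be reduced to the identity if, for some smooth $a:\Sigma_7\to\mathbb R^+$, some torsion coefficient $\hat\kappa=a^p\kappa$ is normalized to a constant whose stabilizer in $K^0$ is trivial. Write $\partial f/\partial\omega^j$ for the coframe derivatives, $df=\sum_j(\partial f/\partial\omega^j)\,\omega^j$. **Theorem.** Suppose that (1) all torsion coefficients on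 which $K^0$ acts nontrivially are constant on $\Sigma_7$, and (2) $K^0$ cannot be reduced to the identity. Then there are $m,n,B\in C^\infty(\Sigma_7)$ such that near every point of $\Sigma_7$ there is a smooth positive function $a$ for which the new coframe $(a^2\omega^1,a\omega^2,a\omega^3,a\omega^4,\omega^5,a\omega^6,\omega^7)$, again denoted $\{\omega^i\}$, satisfies $$\begin{aligned} d\omega^1&=\omega^3\wedge\omega^6+\omega^2\wedge\omega^4,\\ d\omega^2&=\omega^4\wedge\omega^5+\omega^3\wedge\omega^7+\omega^2\wedge\left(-\tfrac{3n}{2}\omega^5+\tfrac m2\omega^7\right),\\ d\omega^3&=\omega^6\wedge\omega^7+\epsilon\,\omega^2\wedge\omega^5+\omega^3\wedge\left(-\tfrac n2\omega^5+\tfrac{3m}{2}\omega^7\right),\\ d\omega^4&=\epsilon\,\omega^5\wedge\omega^6+\omega^2\wedge\left(B\omega^5+\gamma^4{}_{27}\omega^7\right)+\omega^4\wedge\left(\tfrac{3n}{2}\omega^5-\tfrac m2\omega^7\right),\\ d\omega^5&=m\,\omega^5\wedge\omega^7,\\ d\omega^6&=-\omega^4\wedge\omega^7+\omega^3\wedge\left(\gamma^6{}_{35}\omega^5+\epsilon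 B\omega^7\right)+\omega^6\wedge\left(\tfrac n2\omega^5-\tfrac{3m}{2}\omega^7\right),\\ d\omega^7&=n\,\omega^5\wedge\omega^7, \end{aligned}$$ where, with $m_j=\partial m/\partial\omega^j$, $m_{jk}=\partial m_j/\partial\omega^k$ (similarly for $n$) and $\Delta_1=mn+\epsilon$, $$\gamma^4{}_{27}=mn+\epsilon-\tfrac32n_7-\tfrac12m_5,\qquad \gamma^6{}_{35}=mn+\epsilon+\tfrac12n_7+\tfrac32m_5,$$ $$dm=m_5\omega^5+m_7\omega^7,\qquad dn=n_5\omega^5+n_7\omega^7,$$ $$\begin{aligned}dB={}&\epsilon\left(-4m\Delta_1-2n\epsilon B-6mm_5-mn_7+nm_7+\tfrac32m_{57}+\tfrac12n_{77}\right)\omega^5\\&+\left(4n\Delta_1+2mB-6nn_7-nm_5+mn_5-\tfrac12m_{55}-\tfrac32n_{75}\right)\omega^7.\end{aligned}$$ Finally, the integrability conditions of these structure equations reduce to those of $dm,dn,dB$, in the following formal sense. Let $A$ be a commutative $\mathbb R$-algebra (of functions) with derivations $\partial/\partial\omega^1,\dots,\partial/\partial\omega^7$, let $m,n,B,\gamma^4{}_{27},\gamma^6{}_{35}\in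 A$, and extend $d$ by the Leibniz rule to the exterior algebra over $A$ on the symbols $\omega^1,\dots,\omega^7$, with $df=\sum_j(\partial f/\partial\omega^j)\,\omega^j$ for $f\in A$ and $d\omega^i$ given by the seven equations above ($d^2=0$ is not assumed). Then: * if $d^2m=d^2n=0$, then $d^2\omega^i=0$ for all $i$ if and only if $\gamma^4{}_{27},\gamma^6{}_{35},dm,dn,dB$ are given by the formulas above; * if $\gamma^4{}_{27},\gamma^6{}_{35},dm,dn,dB$ are given by the formulas above, then the conditions $d^2\omega^i=0$ (all $i$), $d^2m=d^2n=d^2B=0$ together are equivalent to $d^2m=d^2n=d^2B=0$ alone. -/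

import Mathlib

/-! The members of a coframe are indexed by `Fin 7`, and are referred to by the numerals `1, …, 7`.
In `Fin 7` the numeral `7` is the element `0`, so `1, …, 7` are exactly the seven elements of
`Fin 7`. -/

noncomputable section

namespace GenericHyperbolic

/-- The ambient space; the seven-dimensional manifold is an open subset of it. -/
abbrev E : Type := Fin 7 → ℝ

/-- Covectors, the values of 1-forms. -/
abbrev Covec : Type := E →L[ℝ] ℝ

/-- The wedge product of two covectors, as an alternating function of two vectors. -/
def wedge (α β : Covec) : E → E → ℝ := fun v w => α v * β w - α w * β v

/-- The exterior derivative of a 1-form, as a function of two vectors at each point. -/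
def extD (α : E → Covec) (x : E) : E → E → ℝ := fun v w =>
  extDeriv (fun y => ContinuousAlternatingMap.ofSubsingleton ℝ E ℝ (0 : Fin 1) (α y)) x ![v, w]

/-- A smooth coframe on `U`. -/
def IsCoframeOn (ω : Fin 7 → E → Covec) (U : Set E) : Prop :=
  (∀ i, ContDiffOn ℝ (⊤ : ℕ∞) (ω i) U) ∧ ∀ x ∈ U, LinearIndependent ℝ (fun i => ω i x)

/-- The frame dual to a coframe: `ω i x (dualFrame ω x j)` is `1` if `i = j`, and `0` otherwise. -/
def dualFrame (ω : Fin 7 → E → Covec) (x : E) (j : Fin 7) : E :=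
  (ContinuousLinearMap.pi (fun i => ω i x)).inverse (Pi.single j 1)

/-- The coframe derivative `∂f/∂ωʲ`, so that `df = ∑ j, (∂f/∂ωʲ) ωʲ`. -/
def coframeDeriv (ω : Fin 7 → E → Covec) (j : Fin 7) (f : E → ℝ) : E → ℝ :=
  fun x => fderiv ℝ f x (dualFrame ω x j)

/-- The structure functions `γⁱⱼₖ = - γⁱₖⱼ`, for which `dωⁱ = ½ ∑ γⁱⱼₖ ωʲ ∧ ωᵏ`. -/
def structureCoeff (ω : Fin 7 → E → Covec) (x : E) : Fin 7 → Fin 7 → Fin 7 → ℝ :=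
  fun i j k => extD (ω i) x (dualFrame ω x j) (dualFrame ω x k)

/-- Congruence on `U` of 2-forms modulo the ideal generated by the 1-forms `ω i`, `i ∈ S`. -/
def CongrMod (ω : Fin 7 → E → Covec) (U : Set E) (S : Finset (Fin 7)) (Φ Ψ : E → E → E → ℝ) :
    Prop :=
  ∃ η : Fin 7 → E → Covec, ∀ x ∈ U, Φ x = Ψ x + ∑ i ∈ S, wedge (η i x) (ω i x)

/-- The generic hyperbolic structure equations on `U`. -/
structure GenericHyperbolicOn (ε : ℝ) (ω : Fin 7 → E → Covec) (U : Set E) : Prop where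
  d1 : CongrMod ω U {1} (extD (ω 1)) (fun x => wedge (ω 3 x) (ω 6 x) + wedge (ω 2 x) (ω 4 x))
  d2 : CongrMod ω U {1, 2} (extD (ω 2)) (fun x => wedge (ω 4 x) (ω 5 x) + wedge (ω 3 x) (ω 7 x))
  d3 : CongrMod ω U {1, 3} (extD (ω 3))
    (fun x => wedge (ω 6 x) (ω 7 x) + ε • wedge (ω 2 x) (ω 5 x))
  d4 : CongrMod ω U {1, 2, 4} (extD (ω 4)) (fun x => ε • wedge (ω 5 x) (ω 6 x))
  d5 : CongrMod ω U {1, 2, 4, 5} (extD (ω 5)) (fun _ => 0)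
  d6 : CongrMod ω U {1, 3, 6} (extD (ω 6)) (fun x => - wedge (ω 4 x) (ω 7 x))
  d7 : CongrMod ω U {1, 3, 6, 7} (extD (ω 7)) (fun _ => 0)

/-! ### The group `K⁰ = {diag (a², a, a, a, 1, a, 1) : a > 0}` and torsion -/

/-- The element of `K⁰` with parameter `a` is the diagonal matrix with entries `a ^ weight i`
(`weight 1 = 2`, `weight i = 1` for `i = 2, 3, 4, 6`, `weight 5 = weight 7 = 0`), and its Lie
algebra is spanned by the diagonal matrix with entries `weight i`. -/
def weight : Fin 7 → ℤ := ![0, 2, 1, 1, 1, 0, 1]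

/-- The coframe `g ω`, for the `K⁰`-valued function `g` with parameter `a`. -/
def rescale (a : E → ℝ) (ω : Fin 7 → E → Covec) : Fin 7 → E → Covec :=
  fun i x => (a x ^ weight i) • ω i x

/-- The tensorial action of `K⁰` on structure coefficients,
`γ̂ⁱⱼₖ = gⁱₗ γˡₘₙ (g⁻¹)ᵐⱼ (g⁻¹)ⁿₖ`. -/
def scaleCoeff (a : ℝ) (T : Fin 7 → Fin 7 → Fin 7 → ℝ) : Fin 7 → Fin 7 → Fin 7 → ℝ :=
  fun i j k => a ^ (weight i - weight j - weight k) * T i j k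

/-- The lifted coframe satisfies
`dω̂ⁱ = weight i • α ∧ ω̂ⁱ + ½ ∑ γ̂ⁱⱼₖ ω̂ʲ ∧ ω̂ᵏ`, with `α = da/a`. Passing from `α` to `α + ∑ λⱼ ω̂ʲ`
(Lie algebra valued compatible absorption) subtracts the following tensor from the `γ̂ⁱⱼₖ`. -/
def absorption (lam : Fin 7 → ℝ) : Fin 7 → Fin 7 → Fin 7 → ℝ :=
  fun i j k => (weight i : ℝ) * ((if i = k then lam j else 0) - (if i = j then lam k else 0))

/-- A linear combination of structure coefficients is a torsion coefficient with respect to `K⁰`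
if it is not affected by absorption. -/
def IsTorsionCoeff (κ : (Fin 7 → Fin 7 → Fin 7 → ℝ) →ₗ[ℝ] ℝ) : Prop :=
  ∀ lam : Fin 7 → ℝ, κ (absorption lam) = 0

/-- `K⁰` acts on the coefficient `κ` by scaling with weight `p`: `κ̂ = aᵖ κ`. -/
def HasScalingWeight (κ : (Fin 7 → Fin 7 → Fin 7 → ℝ) →ₗ[ℝ] ℝ) (p : ℤ) : Prop :=
  ∀ a : ℝ, 0 < a → ∀ T, κ (scaleCoeff a T) = a ^ p * κ T

/-- All torsion coefficients on which `K⁰` acts by a nontrivial scaling are constant on `U`. -/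
def NontrivialTorsionConstant (ω : Fin 7 → E → Covec) (U : Set E) : Prop :=
  ∀ (κ : (Fin 7 → Fin 7 → Fin 7 → ℝ) →ₗ[ℝ] ℝ) (p : ℤ),
    IsTorsionCoeff κ → HasScalingWeight κ p → p ≠ 0 →
      ∃ r : ℝ, ∀ x ∈ U, κ (structureCoeff ω x) = r

/-- `K⁰` can be reduced to the identity: by a choice of `a : U → ℝ⁺`, some torsion
coefficient `κ̂ = aᵖ κ` can be normalized to a constant whose stabilizer in `K⁰` is trivial. -/
def ReducibleToIdentity (ω : Fin 7 → E → Covec) (U : Set E) : Prop :=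
  ∃ (κ : (Fin 7 → Fin 7 → Fin 7 → ℝ) →ₗ[ℝ] ℝ) (p : ℤ) (a : E → ℝ) (r : ℝ),
    IsTorsionCoeff κ ∧ HasScalingWeight κ p ∧
    ContDiffOn ℝ (⊤ : ℕ∞) a U ∧ (∀ x ∈ U, 0 < a x) ∧
    (∀ x ∈ U, κ (scaleCoeff (a x) (structureCoeff ω x)) = r) ∧
    ∀ t : ℝ, 0 < t → t ^ p * r = r → t = 1

/-! ### The reduced structure equations

These are written for an arbitrary commutative `ℝ`-algebra `R` of coefficients, so that they can be
read for differential forms at a point as well as for formal expressions in a coframe. -/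

section Reduced

variable {R : Type*} [CommRing R] [Algebra ℝ R]

/-- The equations expressing `dω¹, …, dω⁷` through `m`, `n`, `B`, `g427 = γ⁴₂₇`, `g635 = γ⁶₃₅`. -/
structure ReducedStructureEqs {W X : Type*} [AddCommGroup W] [Module R W]
    [AddCommGroup X] [Module R X] (wdg : W → W → X) (ε : ℝ) (m n B g427 g635 : R)
    (ω : Fin 7 → W) (dω : Fin 7 → X) : Prop where
  d1 : dω 1 = wdg (ω 3) (ω 6) + wdg (ω 2) (ω 4)
  d2 : dω 2 = wdg (ω 4) (ω 5) + wdg (ω 3) (ω 7)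
    + wdg (ω 2) ((-((3 / 2 : ℝ) • n)) • ω 5 + ((1 / 2 : ℝ) • m) • ω 7)
  d3 : dω 3 = wdg (ω 6) (ω 7) + algebraMap ℝ R ε • wdg (ω 2) (ω 5)
    + wdg (ω 3) ((-((1 / 2 : ℝ) • n)) • ω 5 + ((3 / 2 : ℝ) • m) • ω 7)
  d4 : dω 4 = algebraMap ℝ R ε • wdg (ω 5) (ω 6) + wdg (ω 2) (B • ω 5 + g427 • ω 7)
    + wdg (ω 4) (((3 / 2 : ℝ) • n) • ω 5 - ((1 / 2 : ℝ) • m) • ω 7)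
  d5 : dω 5 = m • wdg (ω 5) (ω 7)
  d6 : dω 6 = - wdg (ω 4) (ω 7) + wdg (ω 3) (g635 • ω 5 + (algebraMap ℝ R ε * B) • ω 7)
    + wdg (ω 6) (((1 / 2 : ℝ) • n) • ω 5 - ((3 / 2 : ℝ) • m) • ω 7)
  d7 : dω 7 = n • wdg (ω 5) (ω 7)

/-! In the following, `D j f` stands for the coframe derivative `∂f/∂ωʲ`;
thus `m₅ = D 5 m`, `m₅₇ = D 7 (D 5 m)`, `n₇₅ = D 5 (D 7 n)`, and so on. -/

/-- `γ⁴₂₇ = mn + ε - (3/2) n₇ - (1/2) m₅`. -/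
def gamma427 (D : Fin 7 → R → R) (ε : ℝ) (m n : R) : R :=
  m * n + algebraMap ℝ R ε - (3 / 2 : ℝ) • D 7 n - (1 / 2 : ℝ) • D 5 m

/-- `γ⁶₃₅ = mn + ε + (1/2) n₇ + (3/2) m₅`. -/
def gamma635 (D : Fin 7 → R → R) (ε : ℝ) (m n : R) : R :=
  m * n + algebraMap ℝ R ε + (1 / 2 : ℝ) • D 7 n + (3 / 2 : ℝ) • D 5 m

/-- `Δ₁ = mn + ε`. -/
def Delta1 (ε : ℝ) (m n : R) : R := m * n + algebraMap ℝ R ε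

/-- The coefficient of `ω⁵` in `dB`. -/
def dBcoeff5 (D : Fin 7 → R → R) (ε : ℝ) (m n B : R) : R :=
  algebraMap ℝ R ε * (-4 * m * Delta1 ε m n - 2 * n * algebraMap ℝ R ε * B - 6 * m * D 5 m
    - m * D 7 n + n * D 7 m + (3 / 2 : ℝ) • D 7 (D 5 m) + (1 / 2 : ℝ) • D 7 (D 7 n))

/-- The coefficient of `ω⁷` in `dB`. -/
def dBcoeff7 (D : Fin 7 → R → R) (ε : ℝ) (m n B : R) : R :=
  4 * n * Delta1 ε m n + 2 * m * B - 6 * n * D 7 n - n * D 5 m + m * D 5 n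
    - (1 / 2 : ℝ) • D 5 (D 5 m) - (3 / 2 : ℝ) • D 5 (D 7 n)

end Reduced

/-- On `V`, the coframe `ω` satisfies the reduced structure equations with functions `m`, `n`, `B`,
and `dm`, `dn`, `dB`, `γ⁴₂₇`, `γ⁶₃₅` have the prescribed form. -/
structure ReducedOn (ε : ℝ) (ω : Fin 7 → E → Covec) (m n B : E → ℝ) (V : Set E) : Prop where
  structureEqs : ∀ x ∈ V, ReducedStructureEqs wedge ε (m x) (n x) (B x)
    (gamma427 (coframeDeriv ω) ε m n x) (gamma635 (coframeDeriv ω) ε m n x)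
    (fun i => ω i x) (fun i => extD (ω i) x)
  dm : ∀ x ∈ V, fderiv ℝ m x = coframeDeriv ω 5 m x • ω 5 x + coframeDeriv ω 7 m x • ω 7 x
  dn : ∀ x ∈ V, fderiv ℝ n x = coframeDeriv ω 5 n x • ω 5 x + coframeDeriv ω 7 n x • ω 7 x
  dB : ∀ x ∈ V, fderiv ℝ B x = dBcoeff5 (coframeDeriv ω) ε m n B x • ω 5 x
    + dBcoeff7 (coframeDeriv ω) ε m n B x • ω 7 x

/-! ### Formal exterior calculus in a coframe

Integrability conditions are computed formally: `A` is an algebra of functions, the formal coframe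
has `df = ∑ j, (D j f) ωʲ` and `dωⁱ = ½ ∑ γⁱⱼₖ ωʲ ∧ ωᵏ`, and `d` is extended to forms by the
Leibniz rule, without assuming that its square vanishes. Forms are given by their components:
`(β j)` stands for `∑ βⱼ ωʲ`, and an antisymmetric `(Ω j k)` for `½ ∑ Ωⱼₖ ωʲ ∧ ωᵏ`. -/

section Formal

variable {A : Type*} [CommRing A] [Algebra ℝ A]

/-- The components of the formal coframe. -/
def formalCoframe (A : Type*) [CommRing A] : Fin 7 → Fin 7 → A := fun i => Pi.single i 1

/-- The wedge product of two formal 1-forms. -/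
def formalWedge (α β : Fin 7 → A) : Fin 7 → Fin 7 → A := fun j k => α j * β k - α k * β j

/-- The differential of a function. -/
def formalD0 (D : Fin 7 → Derivation ℝ A A) (f : A) : Fin 7 → A := fun j => D j f

/-- The differential of a 1-form, `d(∑ βᵢ ωⁱ) = ∑ dβᵢ ∧ ωⁱ + ∑ βᵢ dωⁱ`. -/
def formalD1 (D : Fin 7 → Derivation ℝ A A) (γ : Fin 7 → Fin 7 → Fin 7 → A) (β : Fin 7 → A) :
    Fin 7 → Fin 7 → A :=
  fun j k => D j (β k) - D k (β j) + ∑ i, β i * γ i j k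

/-- The differential of a 2-form,
`d(½ ∑ Ωₐᵦ ωᵃ ∧ ωᵇ) = ½ ∑ dΩₐᵦ ∧ ωᵃ ∧ ωᵇ + ∑ Ωₐᵦ dωᵃ ∧ ωᵇ`. -/
def formalD2 (D : Fin 7 → Derivation ℝ A A) (γ : Fin 7 → Fin 7 → Fin 7 → A)
    (Ω : Fin 7 → Fin 7 → A) : Fin 7 → Fin 7 → Fin 7 → A :=
  fun j k l => D j (Ω k l) + D k (Ω l j) + D l (Ω j k)
    + ∑ a, (γ a j k * Ω a l + γ a k l * Ω a j + γ a l j * Ω a k)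

/-- The integrability conditions `d²ωⁱ = 0` for all `i`. -/
def CoframeIntegrable (D : Fin 7 → Derivation ℝ A A) (γ : Fin 7 → Fin 7 → Fin 7 → A) : Prop :=
  ∀ i, formalD2 D γ (γ i) = 0

/-- The integrability condition `d²f = 0` for a function `f`. -/
def FunctionIntegrable (D : Fin 7 → Derivation ℝ A A) (γ : Fin 7 → Fin 7 → Fin 7 → A) (f : A) :
    Prop :=
  formalD1 D γ (formalD0 D f) = 0

/-- The prescribed form of `dm`, `dn`, `dB`, `γ⁴₂₇`, `γ⁶₃₅`, in formal terms. -/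
structure FormalRelations (D : Fin 7 → Derivation ℝ A A) (ε : ℝ) (m n B g427 g635 : A) :
    Prop where
  dm : formalD0 D m = D 5 m • formalCoframe A 5 + D 7 m • formalCoframe A 7
  dn : formalD0 D n = D 5 n • formalCoframe A 5 + D 7 n • formalCoframe A 7
  dB : formalD0 D B = dBcoeff5 (fun j => D j) ε m n B • formalCoframe A 5
    + dBcoeff7 (fun j => D j) ε m n B • formalCoframe A 7
  h427 : g427 = gamma427 (fun j => D j) ε m n
  h635 : g635 = gamma635 (fun j => D j) ε m n

end Formal

end GenericHyperbolic

end

/-! Absorption writes dωⁱ = wᵢ φ ∧ ωⁱ + Rⁱ, where the 1-form φ and the remaining torsion R depend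
linearly on γ, and Rⁱⱼₖ is a torsion coefficient of scaling weight wᵢ - wⱼ - wₖ. If this weight is
nonzero, Rⁱⱼₖ is constant by (1). A nonzero constant would have trivial stabilizer, against (2), so
it is zero (`reducedTorsion_eq_zero`). Hence R is homogeneous, and the hyperbolic congruences leave
fourteen unknown functions in it (`reducedTorsion_eq_coeffTable`).

By homogeneity the terms φ ∧ Rⁱ cancel in d²ωⁱ, which becomes wᵢ dφ ∧ ωⁱ plus the expression formed
from R alone (`formalD2_twist`). Components of d²ωⁱ = 0 free of dφ express nine of the fourteen
functions through m, n, B; others then give dφ = 0 (`reducedStructureEqs_of_twist`). So φ = -da/a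
locally. Rescaling by a removes φ and leaves R unchanged (`structureCoeff_rescale`), which is why m,
n, B live on the whole open set although a is only local.

The remaining formulas express d²ωⁱ = 0 for the rescaled coframe. This is a computation in any
ℝ-algebra with seven derivations (`formal_integrability_conditions`), which also yields the formal
assertions. For the analytic part the algebra consists of the smooth functions on an open set; there
d² = 0 on functions is the symmetry of second derivatives, and d²ωⁱ = 0 follows by the Jacobi
identity (`coframeIntegrable_of_forall_functionIntegrable`). -/

namespace GenericHyperbolic

set_option linter.unusedSimpArgs false

/-! ### Tables of structure coefficients and the sufficiency of the formulas -/

section FormalAlgebra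

variable {A : Type*} [CommRing A]

/-- The components of `c ωᵖ ∧ ω^q`, for `p ≠ q`. -/
def skew (p q : Fin 7) (c : A) : Fin 7 → Fin 7 → A :=
  fun j k => if j = p ∧ k = q then c else if j = q ∧ k = p then -c else 0

/-- Structure coefficients for which `dωⁱ` has the weight of `ωⁱ`. -/
def coeffTable (e m n a2 b2 a3 b3 a4 b4 a6 b6 B C F G : A) : Fin 7 → Fin 7 → Fin 7 → A :=
  -- The index 7 is 0 in `Fin 7`, so the rows are dω⁷, dω¹, …, dω⁶.
  ![skew 5 7 n,
    skew 3 6 1 + skew 2 4 1,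
    skew 4 5 1 + skew 3 7 1 + (skew 2 5 a2 + skew 2 7 b2),
    skew 6 7 1 + skew 2 5 e + (skew 3 5 a3 + skew 3 7 b3),
    skew 5 6 e + (skew 2 5 B + skew 2 7 C) + (skew 4 5 a4 + skew 4 7 b4),
    skew 5 7 m,
    skew 4 7 (-1) + (skew 3 5 F + skew 3 7 G) + (skew 6 5 a6 + skew 6 7 b6)]

section Rows

variable (e m n a2 b2 a3 b3 a4 b4 a6 b6 B C F G : A)

theorem coeffTable_zero : coeffTable e m n a2 b2 a3 b3 a4 b4 a6 b6 B C F G 0 =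
    skew 5 7 n := rfl

theorem coeffTable_one : coeffTable e m n a2 b2 a3 b3 a4 b4 a6 b6 B C F G 1 =
    skew 3 6 1 + skew 2 4 1 := rfl

theorem coeffTable_two : coeffTable e m n a2 b2 a3 b3 a4 b4 a6 b6 B C F G 2 =
    skew 4 5 1 + skew 3 7 1 + (skew 2 5 a2 + skew 2 7 b2) := rfl

theorem coeffTable_three : coeffTable e m n a2 b2 a3 b3 a4 b4 a6 b6 B C F G 3 =
    skew 6 7 1 + skew 2 5 e + (skew 3 5 a3 + skew 3 7 b3) := rfl

theorem coeffTable_four : coeffTable e m n a2 b2 a3 b3 a4 b4 a6 b6 B C F G 4 =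
    skew 5 6 e + (skew 2 5 B + skew 2 7 C) + (skew 4 5 a4 + skew 4 7 b4) := rfl

theorem coeffTable_five : coeffTable e m n a2 b2 a3 b3 a4 b4 a6 b6 B C F G 5 =
    skew 5 7 m := rfl

theorem coeffTable_six : coeffTable e m n a2 b2 a3 b3 a4 b4 a6 b6 B C F G 6 =
    skew 4 7 (-1) + (skew 3 5 F + skew 3 7 G) + (skew 6 5 a6 + skew 6 7 b6) := rfl

end Rows

theorem smul_formalWedge_formalCoframe (c : A) {p q : Fin 7} (hpq : p ≠ q) :
    c • formalWedge (formalCoframe A p) (formalCoframe A q) = skew p q c := by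
  ext j k
  simp only [Pi.smul_apply, formalWedge, formalCoframe, Pi.single_apply, skew, smul_eq_mul]
  by_cases h1 : j = p <;> by_cases h2 : k = q <;> by_cases h3 : j = q <;> by_cases h4 : k = p <;>
    simp_all

theorem formalWedge_formalCoframe {p q : Fin 7} (hpq : p ≠ q) :
    formalWedge (formalCoframe A p) (formalCoframe A q) = skew p q 1 := by
  rw [← smul_formalWedge_formalCoframe 1 hpq, one_smul]

theorem smul_skew_one (p q : Fin 7) (c : A) : c • skew p q (1 : A) = skew p q c := by
  ext j k
  simp only [skew, Pi.smul_apply, smul_eq_mul]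
  split_ifs <;> simp

theorem formalWedge_add_right (α β₁ β₂ : Fin 7 → A) :
    formalWedge α (β₁ + β₂) = formalWedge α β₁ + formalWedge α β₂ := by
  ext j k; simp only [formalWedge, Pi.add_apply]; ring

theorem formalWedge_smul_right (c : A) (α β : Fin 7 → A) :
    formalWedge α (c • β) = c • formalWedge α β := by
  ext j k; simp only [formalWedge, Pi.smul_apply, smul_eq_mul]; ring

theorem skew_neg (p q : Fin 7) (c : A) : skew p q (-c) = -skew p q c := by
  ext j k
  simp only [skew, Pi.neg_apply]
  split_ifs <;> simp

theorem skew_swap {p q : Fin 7} (hpq : p ≠ q) (c : A) (j k : Fin 7) :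
    skew p q c k j = -skew p q c j k := by
  simp only [skew]
  by_cases h1 : j = p <;> by_cases h2 : k = q <;> by_cases h3 : j = q <;> by_cases h4 : k = p <;>
    simp_all

theorem coeffTable_swap (e m n a2 b2 a3 b3 a4 b4 a6 b6 B C F G : A) (i j k : Fin 7) :
    coeffTable e m n a2 b2 a3 b3 a4 b4 a6 b6 B C F G i k j =
      -coeffTable e m n a2 b2 a3 b3 a4 b4 a6 b6 B C F G i j k := by
  have h : ∀ {p q : Fin 7}, p ≠ q → ∀ c : A, skew p q c k j = -skew p q c j k :=
    fun hpq c => skew_swap hpq c j k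
  fin_cases i <;>
    simp (disch := decide) only [coeffTable, Fin.reduceFinMk, Fin.zero_eta, Fin.mk_one,
      Matrix.cons_val, Pi.add_apply, h] <;> ring

/-- Trades the structure equations for an explicit table, on which the components of d² can be
evaluated one at a time. -/
theorem reducedStructureEqs_formal_iff [Algebra ℝ A] {ε : ℝ} {m n B C F : A}
    {γ : Fin 7 → Fin 7 → Fin 7 → A} :
    ReducedStructureEqs formalWedge ε m n B C F (formalCoframe A) γ ↔
      γ = coeffTable (algebraMap ℝ A ε) m n (-((3 / 2 : ℝ) • n)) ((1 / 2 : ℝ) • m)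
        (-((1 / 2 : ℝ) • n)) ((3 / 2 : ℝ) • m) ((3 / 2 : ℝ) • n) (-((1 / 2 : ℝ) • m))
        ((1 / 2 : ℝ) • n) (-((3 / 2 : ℝ) • m)) B C F (algebraMap ℝ A ε * B) := by
  have e1 : ∀ f g : Fin 7 → Fin 7 → Fin 7 → A, f = g ↔ f 1 = g 1 ∧ f 2 = g 2 ∧ f 3 = g 3 ∧
      f 4 = g 4 ∧ f 5 = g 5 ∧ f 6 = g 6 ∧ f 7 = g 7 := by
    refine fun f g => ⟨fun h => by simp [h], fun h => funext fun i => ?_⟩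
    obtain ⟨h1, h2, h3, h4, h5, h6, h7⟩ := h
    fin_cases i <;> assumption
  rw [e1]
  constructor
  · rintro ⟨h1, h2, h3, h4, h5, h6, h7⟩
    rw [h1, h2, h3, h4, h5, h6, h7]
    simp (disch := decide) only [coeffTable, Fin.isValue, Matrix.cons_val, sub_eq_add_neg,
      ← neg_smul, formalWedge_add_right, formalWedge_smul_right, formalWedge_formalCoframe,
      smul_skew_one, skew_neg, and_self]
  · rintro ⟨h1, h2, h3, h4, h5, h6, h7⟩
    constructor <;>
    simp (disch := decide) only [h1, h2, h3, h4, h5, h6, show γ 0 = _ from h7, coeffTable,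
      Fin.isValue, Matrix.cons_val, sub_eq_add_neg,
      ← neg_smul, formalWedge_add_right, formalWedge_smul_right, formalWedge_formalCoframe,
      smul_skew_one, skew_neg]

variable [Algebra ℝ A]

theorem eq_zero_of_two_mul_eq_zero {x : A} (h : 2 * x = 0) : x = 0 := by
  have h2 : (2 : ℝ) • x = 0 := by rw [two_smul, ← two_mul, h]
  exact (smul_eq_zero_iff_right two_ne_zero).1 h2

/-- The increasing triples of indices. -/
def increasingTriples : List (Fin 7 × Fin 7 × Fin 7) :=
  [(0, 1, 2), (0, 1, 3), (0, 1, 4), (0, 1, 5), (0, 1, 6), (0, 2, 3), (0, 2, 4), (0, 2, 5),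
    (0, 2, 6), (0, 3, 4), (0, 3, 5), (0, 3, 6), (0, 4, 5), (0, 4, 6), (0, 5, 6), (1, 2, 3),
    (1, 2, 4), (1, 2, 5), (1, 2, 6), (1, 3, 4), (1, 3, 5), (1, 3, 6), (1, 4, 5), (1, 4, 6),
    (1, 5, 6), (2, 3, 4), (2, 3, 5), (2, 3, 6), (2, 4, 5), (2, 4, 6), (2, 5, 6), (3, 4, 5),
    (3, 4, 6), (3, 5, 6), (4, 5, 6)]

theorem mem_increasingTriples :
    ∀ j k l : Fin 7, j < k → k < l → (j, k, l) ∈ increasingTriples := by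
  decide

/-- The components are totally antisymmetric: cyclic symmetry is visible in the formula, and the
antisymmetry of γ and Ω gives the sign of a swap. Components with a repeated index vanish because 2
is invertible. So 35 components decide. -/
theorem formalD2_eq_zero (D : Fin 7 → Derivation ℝ A A)
    (γ : Fin 7 → Fin 7 → Fin 7 → A) (Ω : Fin 7 → Fin 7 → A)
    (hγ : ∀ i j k, γ i k j = -γ i j k) (hΩ : ∀ j k, Ω k j = -Ω j k)
    (h : ∀ t ∈ increasingTriples, formalD2 D γ Ω t.1 t.2.1 t.2.2 = 0) :
    formalD2 D γ Ω = 0 := by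
  replace h : ∀ j k l, j < k → k < l → formalD2 D γ Ω j k l = 0 := fun j k l hjk hkl =>
    h _ (mem_increasingTriples j k l hjk hkl)
  have cyc : ∀ j k l, formalD2 D γ Ω j k l = formalD2 D γ Ω k l j := by
    intro j k l
    simp only [formalD2]
    rw [Finset.sum_congr rfl fun a _ =>
      show _ = γ a k l * Ω a j + γ a l j * Ω a k + γ a j k * Ω a l by ring]
    ring
  have anti : ∀ j k l, formalD2 D γ Ω k j l = -formalD2 D γ Ω j k l := by
    intro j k l
    simp only [formalD2]
    rw [hΩ k j, hΩ j l, hΩ l k, Finset.sum_congr rfl fun a _ =>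
      show _ = -(γ a j k * Ω a l + γ a k l * Ω a j + γ a l j * Ω a k) by
        rw [hγ a j k, hγ a k l, hγ a l j]; ring, Finset.sum_neg_distrib]
    simp only [map_neg]
    ring
  have refl : ∀ j l, formalD2 D γ Ω j j l = 0 := fun j l =>
    eq_zero_of_two_mul_eq_zero (by linear_combination anti j j l)
  have key : ∀ j k l, j < k → formalD2 D γ Ω j k l = 0 := by
    intro j k l hjk
    rcases lt_trichotomy k l with hkl | rfl | hkl
    · exact h j k l hjk hkl
    · rw [cyc]; exact refl _ _
    · rcases lt_trichotomy j l with hjl | rfl | hjl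
      · rw [cyc, cyc, ← neg_eq_zero, ← anti]; exact h _ _ _ hjl hkl
      · rw [cyc, cyc]; exact refl _ _
      · rw [← cyc]; exact h _ _ _ hjl hjk
  ext j k l
  rcases lt_trichotomy j k with hjk | rfl | hjk
  · exact key _ _ _ hjk
  · exact refl _ _
  · rw [anti, key _ _ _ hjk, neg_zero]; rfl

theorem map_two (d : Derivation ℝ A A) : d 2 = 0 := by
  rw [← one_add_one_eq_two, map_add, d.map_one_eq_zero, add_zero]

theorem map_three (d : Derivation ℝ A A) : d 3 = 0 := by
  rw [← two_add_one_eq_three, map_add, d.map_one_eq_zero, map_two, add_zero]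

/-- The coefficients of the reduced structure equations with `m = 2 μ`, `n = 2 ν`. -/
def halfTable (e μ ν B C F : A) : Fin 7 → Fin 7 → Fin 7 → A :=
  coeffTable e (2 * μ) (2 * ν) (-(3 * ν)) μ (-ν) (3 * μ) (3 * ν) (-μ) ν (-(3 * μ)) B C F (e * B)

-- Halving m and n leaves only integer multiples, so that `ring` can verify the components over A.
set_option maxHeartbeats 4000000 in
theorem coframeIntegrable_halfTable (D : Fin 7 → Derivation ℝ A A) (e μ ν B C F : A)
    (he : e * e = 1) (hD : ∀ j, D j e = 0)
    (hμ : ∀ j, j ≠ 5 → j ≠ 7 → D j μ = 0) (hν : ∀ j, j ≠ 5 → j ≠ 7 → D j ν = 0)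
    (hB : ∀ j, j ≠ 5 → j ≠ 7 → D j B = 0) (hC : ∀ j, j ≠ 5 → j ≠ 7 → D j C = 0)
    (hF : ∀ j, j ≠ 5 → j ≠ 7 → D j F = 0)
    (h2 : C = 4 * μ * ν + e - 3 * D 7 ν - D 5 μ) (h3 : F = 4 * μ * ν + e + D 7 ν + 3 * D 5 μ)
    (h4 : D 7 B = D 5 C + 8 * C * ν + 4 * B * μ)
    (h6 : e * D 5 B = D 7 F - 4 * e * B * ν - 8 * F * μ) :
    CoframeIntegrable D (halfTable e μ ν B C F) := by
  intro i
  have hz : ∀ {f : A}, (∀ j, j ≠ 5 → j ≠ 7 → D j f = 0) →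
      D 1 f = 0 ∧ D 2 f = 0 ∧ D 3 f = 0 ∧ D 4 f = 0 ∧ D 6 f = 0 := fun h =>
    ⟨h 1 (by decide) (by decide), h 2 (by decide) (by decide), h 3 (by decide) (by decide),
      h 4 (by decide) (by decide), h 6 (by decide) (by decide)⟩
  replace h6 : D 5 B = e * (D 7 F - 4 * e * B * ν - 8 * F * μ) := by
    linear_combination e * h6 - D 5 B * he
  -- Normalizes the numeral 7 to 0, the form in which it occurs in the expanded components.
  simp only [Fin.isValue] at h2 h3 h4 h6
  refine formalD2_eq_zero D _ _ (coeffTable_swap _ _ _ _ _ _ _ _ _ _ _ _ _ _ _)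
    (coeffTable_swap _ _ _ _ _ _ _ _ _ _ _ _ _ _ _ _) ?_
  generalize hγ : halfTable e μ ν B C F = γ
  have r0 : γ 0 = _ := (congrFun hγ 0).symm.trans (coeffTable_zero ..)
  have r1 : γ 1 = _ := (congrFun hγ 1).symm.trans (coeffTable_one ..)
  have r2 : γ 2 = _ := (congrFun hγ 2).symm.trans (coeffTable_two ..)
  have r3 : γ 3 = _ := (congrFun hγ 3).symm.trans (coeffTable_three ..)
  have r4 : γ 4 = _ := (congrFun hγ 4).symm.trans (coeffTable_four ..)
  have r5 : γ 5 = _ := (congrFun hγ 5).symm.trans (coeffTable_five ..)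
  have r6 : γ 6 = _ := (congrFun hγ 6).symm.trans (coeffTable_six ..)
  fin_cases i <;> simp only [Fin.reduceFinMk, Fin.zero_eta, Fin.mk_one, r0, r1, r2, r3, r4, r5, r6,
    increasingTriples, List.forall_mem_cons, List.not_mem_nil, false_imp_iff, implies_true,
    and_true] <;>
  simp only [formalD2, Fin.sum_univ_seven] <;>
  simp only [Pi.add_apply, skew, Fin.isValue, Fin.reduceEq, and_true, and_false, if_true, if_false,
    map_zero, add_zero, zero_add, mul_zero, zero_mul, map_add, map_neg, Derivation.leibniz,
    smul_eq_mul, map_two, map_three, hD, hz hμ, hz hν, hz hB, hz hC, hz hF,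
    Derivation.map_one_eq_zero, neg_zero, h4, h6, true_and] <;>
  simp only [r0, r1, r2, r3, r4, r5, r6, Pi.add_apply, skew, Fin.isValue, Fin.reduceEq, and_true,
    and_false, if_true, if_false, map_zero, add_zero, zero_add, mul_zero, zero_mul, neg_zero,
    true_and]
  · exact ⟨by ring, by ring, by ring, by ring, by ring, by ring⟩
  · exact ⟨by linear_combination -h2, by ring, by ring⟩
  · exact ⟨by ring, by linear_combination h3, by ring⟩
  · exact ⟨by ring, by linear_combination B * he, by linear_combination h2, by ring⟩
  · exact ⟨by linear_combination B * he,
      by linear_combination -(D 0 F - 4 * e * B * ν - 8 * F * μ) * he, by ring,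
      by linear_combination h3⟩

end FormalAlgebra

/-! ### Necessity of the formulas and the formal equivalence -/

section FormalPart

variable {A : Type*} [CommRing A] [Algebra ℝ A]

/-- d²ω⁷ and d²ω⁵ are dn ∧ ω⁵ ∧ ω⁷ and dm ∧ ω⁵ ∧ ω⁷. The formulas for C and F are the ω²⁵⁷ component
of d²ω² and the ω³⁵⁷ component of d²ω³; those for dB come from d²ω⁴ and d²ω⁶. -/
theorem of_coframeIntegrable_halfTable {D : Fin 7 → Derivation ℝ A A} {e μ ν B C F : A}
    (he : e * e = 1) (hD : ∀ j, D j e = 0)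
    (h : CoframeIntegrable D (halfTable e μ ν B C F)) :
    (∀ j, j ≠ 5 → j ≠ 7 → D j μ = 0) ∧ (∀ j, j ≠ 5 → j ≠ 7 → D j ν = 0) ∧
    (∀ j, j ≠ 5 → j ≠ 7 → D j B = 0) ∧
    C = 4 * μ * ν + e - 3 * D 7 ν - D 5 μ ∧ F = 4 * μ * ν + e + D 7 ν + 3 * D 5 μ ∧
    D 7 B = D 5 C + 8 * C * ν + 4 * B * μ ∧
    e * D 5 B = D 7 F - 4 * e * B * ν - 8 * F * μ := by
  generalize hγ : halfTable e μ ν B C F = γ at h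
  have r0 : γ 0 = _ := (congrFun hγ 0).symm.trans (coeffTable_zero ..)
  have r1 : γ 1 = _ := (congrFun hγ 1).symm.trans (coeffTable_one ..)
  have r2 : γ 2 = _ := (congrFun hγ 2).symm.trans (coeffTable_two ..)
  have r3 : γ 3 = _ := (congrFun hγ 3).symm.trans (coeffTable_three ..)
  have r4 : γ 4 = _ := (congrFun hγ 4).symm.trans (coeffTable_four ..)
  have r5 : γ 5 = _ := (congrFun hγ 5).symm.trans (coeffTable_five ..)
  have r6 : γ 6 = _ := (congrFun hγ 6).symm.trans (coeffTable_six ..)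
  have c : ∀ i j k l, formalD2 D γ (γ i) j k l = 0 := fun i j k l => by rw [h i]; rfl
  have c0 := And.intro (c 0 1 5 7) <| And.intro (c 0 2 5 7) <| And.intro (c 0 3 5 7) <|
    And.intro (c 0 4 5 7) (c 0 6 5 7)
  have c5 := And.intro (c 5 1 5 7) <| And.intro (c 5 2 5 7) <| And.intro (c 5 3 5 7) <|
    And.intro (c 5 4 5 7) (c 5 6 5 7)
  have c4 := And.intro (c 4 1 2 5) <| And.intro (c 4 2 3 5) <| And.intro (c 4 2 4 5) <|
    And.intro (c 4 2 5 6) (c 4 2 5 7)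
  have c6 := And.intro (c 6 2 3 7) (c 6 3 5 7)
  have c2 := c 2 2 5 7
  have c3 := c 3 3 5 7
  clear c h
  simp only [r0, r1, r2, r3, r4, r5, r6] at c0 c5 c2 c3 c4 c6
  simp only [formalD2, Fin.sum_univ_seven] at c0 c5 c2 c3 c4 c6
  simp only [Pi.add_apply, skew, Fin.isValue, Fin.reduceEq, and_true, and_false, if_true, if_false,
    map_zero, add_zero, zero_add, mul_zero, zero_mul, map_add, map_neg, Derivation.leibniz,
    smul_eq_mul, map_two, map_three, hD, Derivation.map_one_eq_zero, neg_zero,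
    true_and] at c0 c5 c2 c3 c4 c6
  simp only [r0, r1, r2, r3, r4, r5, r6, Pi.add_apply, skew, Fin.isValue, Fin.reduceEq, and_true,
    and_false, if_true, if_false, add_zero, zero_add, mul_zero, zero_mul, neg_zero,
    true_and] at c0 c5 c2 c3 c4 c6
  clear r0 r1 r2 r3 r4 r5 r6
  have all : ∀ {f : A}, D 1 f = 0 → D 2 f = 0 → D 3 f = 0 → D 4 f = 0 → D 6 f = 0 →
      ∀ j, j ≠ 5 → j ≠ 7 → D j f = 0 := by
    intro f h1 h2 h3 h4 h6 j h5 h7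
    fin_cases j
    · exact absurd rfl h7
    all_goals first | assumption | exact absurd rfl h5
  have z : ∀ {f : A}, 2 * f = 0 → f = 0 := eq_zero_of_two_mul_eq_zero
  obtain ⟨m1, m2, m3, m4, m6⟩ := c5
  obtain ⟨n1, n2, n3, n4, n6⟩ := c0
  obtain ⟨b1, b3, b4, b6, hb⟩ := c4
  obtain ⟨b2, hf⟩ := c6
  have b2 : D 2 B = 0 := by linear_combination e * b2 - D 2 B * he
  -- The ω²⁴⁵ component of d²ω⁴ also contains the ω²-derivative of the coefficient 3ν, which is
  -- already known to vanish.
  have b4 : D 4 B = 0 := by linear_combination 3 * z n2 - b4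
  refine ⟨all (z m1) (z m2) (z m3) (z m4) (z m6), all (z n1) (z n2) (z n3) (z n4) (z n6),
    all b1 b2 (neg_eq_zero.1 b3) b4 b6, ?_, ?_, ?_, ?_⟩ <;> simp only [Fin.isValue]
  · linear_combination -c2
  · linear_combination c3
  · linear_combination hb
  · linear_combination -hf

theorem formalD0_eq_iff {D : Fin 7 → Derivation ℝ A A} {f a b : A} :
    formalD0 D f = a • formalCoframe A 5 + b • formalCoframe A 7 ↔
      (∀ j, j ≠ 5 → j ≠ 7 → D j f = 0) ∧ D 5 f = a ∧ D 7 f = b := by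
  constructor
  · intro h
    have h' : ∀ j, D j f = a * (if j = 5 then 1 else 0) + b * (if j = 7 then 1 else 0) := by
      intro j
      have := congrFun h j
      simpa [formalD0, formalCoframe, Pi.single_apply] using this
    refine ⟨fun j h5 h7 => by rw [h' j, if_neg h5, if_neg h7]; ring, by simp [h'], by simp [h']⟩
  · rintro ⟨h, h5, h7⟩
    ext j
    by_cases j5 : j = 5
    · subst j5; simp [formalD0, formalCoframe, h5]
    · by_cases j7 : j = 7
      · subst j7; simp [formalD0, formalCoframe]; exact h7
      · simp only [formalD0, formalCoframe, Pi.add_apply, Pi.smul_apply, Pi.single_apply, j5,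
          j7, h j j5 j7,
          if_false, smul_zero, add_zero]

/-- In the (j,5) and (j,7) components of d²f = 0 the derivative D j f vanishes, and only dω⁵ and dω⁷
enter the correction; both are multiples of ω⁵ ∧ ω⁷. -/
theorem deriv_deriv_eq_zero {D : Fin 7 → Derivation ℝ A A} {e μ ν B C F f : A}
    (hf : ∀ j, j ≠ 5 → j ≠ 7 → D j f = 0)
    (h : FunctionIntegrable D (halfTable e μ ν B C F) f) (j : Fin 7) (h5 : j ≠ 5) (h7 : j ≠ 7) :
    D j (D 5 f) = 0 ∧ D j (D 7 f) = 0 := by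
  have e5 := congrFun (congrFun h j) 5
  have e7 := congrFun (congrFun h j) 7
  simp only [formalD1, formalD0, Fin.sum_univ_seven, hf j h5 h7, map_zero] at e5 e7
  have hz : D 1 f = 0 ∧ D 2 f = 0 ∧ D 3 f = 0 ∧ D 4 f = 0 ∧ D 6 f = 0 :=
    ⟨hf 1 (by decide) (by decide), hf 2 (by decide) (by decide), hf 3 (by decide) (by decide),
      hf 4 (by decide) (by decide), hf 6 (by decide) (by decide)⟩
  have h0 : j ≠ 0 := h7
  have t0 : halfTable e μ ν B C F 0 = _ := coeffTable_zero ..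
  have t5 : halfTable e μ ν B C F 5 = _ := coeffTable_five ..
  simp [hz, t0, t5, skew, h5, h0] at e5 e7
  exact ⟨e5, e7⟩

theorem half_smul_two_mul (x : A) : (1 / 2 : ℝ) • (2 * x) = x := by
  rw [two_mul, ← two_smul ℝ, smul_smul]; norm_num

theorem three_halves_smul_two_mul (x : A) : (3 / 2 : ℝ) • (2 * x) = 3 * x := by
  rw [show (3 / 2 : ℝ) = 1 / 2 + 1 / 2 + 1 / 2 by norm_num, add_smul, add_smul, half_smul_two_mul]
  ring

-- For the converse, d²m = d²n = 0 is what makes γ⁴₂₇ and γ⁶₃₅ constant in the directions other than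
-- 5 and 7: they contain m₅ and n₇, to which `deriv_deriv_eq_zero` applies.
set_option maxHeartbeats 1000000 in
theorem formal_integrability_conditions {ε : ℝ} (hε : ε = 1 ∨ ε = -1)
    (D : Fin 7 → Derivation ℝ A A) (γ : Fin 7 → Fin 7 → Fin 7 → A) (m n B C F : A)
    (h : ReducedStructureEqs formalWedge ε m n B C F (formalCoframe A) γ) :
    FunctionIntegrable D γ m → FunctionIntegrable D γ n →
      (CoframeIntegrable D γ ↔ FormalRelations D ε m n B C F) := by
  have hm : m = 2 * ((1 / 2 : ℝ) • m) := by
    rw [two_mul, ← two_smul ℝ, smul_smul]; norm_num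
  have hn : n = 2 * ((1 / 2 : ℝ) • n) := by
    rw [two_mul, ← two_smul ℝ, smul_smul]; norm_num
  generalize (1 / 2 : ℝ) • m = μ at hm
  generalize (1 / 2 : ℝ) • n = ν at hn
  subst hm hn
  rw [reducedStructureEqs_formal_iff] at h
  simp only [half_smul_two_mul, three_halves_smul_two_mul] at h
  have h : γ = halfTable (algebraMap ℝ A ε) μ ν B C F := h
  have hD : ∀ j, D j (algebraMap ℝ A ε) = 0 := fun j => (D j).map_algebraMap ε
  have he : algebraMap ℝ A ε * algebraMap ℝ A ε = 1 := by
    rw [← map_mul]; rcases hε with rfl | rfl <;> simp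
  have d2 : ∀ j x, D j (2 * x) = 2 * D j x := fun j x => by simp [Derivation.leibniz, map_two]
  have d4 : ∀ j, D j 4 = 0 := fun j => by
    rw [show (4 : A) = 2 * 2 by norm_num, d2, map_two, mul_zero]
  have z2 : ∀ {f}, (∀ j, j ≠ 5 → j ≠ 7 → D j (2 * f) = 0) ↔ ∀ j, j ≠ 5 → j ≠ 7 → D j f = 0 :=
    fun {f} => ⟨fun h j h5 h7 => eq_zero_of_two_mul_eq_zero (by rw [← d2, h j h5 h7]),
      fun h j h5 h7 => by rw [d2, h j h5 h7, mul_zero]⟩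
  have g4 : gamma427 (fun j => D j) ε (2 * μ) (2 * ν) =
      4 * μ * ν + algebraMap ℝ A ε - 3 * D 7 ν - D 5 μ := by
    simp only [gamma427, d2, half_smul_two_mul, three_halves_smul_two_mul]; ring
  have g6 : gamma635 (fun j => D j) ε (2 * μ) (2 * ν) =
      4 * μ * ν + algebraMap ℝ A ε + D 7 ν + 3 * D 5 μ := by
    simp only [gamma635, d2, half_smul_two_mul, three_halves_smul_two_mul]; ring
  have i2 : ∀ {f : A}, FunctionIntegrable D γ (2 * f) → FunctionIntegrable D γ f := by
    intro f hf
    ext j k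
    refine eq_zero_of_two_mul_eq_zero ?_
    have hjk := congrFun (congrFun hf j) k
    simp only [formalD1, formalD0, d2, Pi.zero_apply, mul_assoc, ← Finset.mul_sum] at hjk
    rw [formalD1, ← hjk]
    simp only [formalD0]
    ring
  intro Hm Hn
  rw [h] at Hm Hn i2 ⊢
  generalize he0 : algebraMap ℝ A ε = e at *
  constructor
  · intro H
    obtain ⟨hμ, hν, hB, h2, h3, h4, h6⟩ := of_coframeIntegrable_halfTable he hD H
    refine ⟨formalD0_eq_iff.2 ⟨z2.2 hμ, rfl, rfl⟩, formalD0_eq_iff.2 ⟨z2.2 hν, rfl, rfl⟩,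
      formalD0_eq_iff.2 ⟨hB, ?_, ?_⟩, h2.trans g4.symm, h3.trans g6.symm⟩
    · have e7 : D 7 F = 4 * (D 7 μ * ν + μ * D 7 ν) + D 7 (D 7 ν) + 3 * D 7 (D 5 μ) := by
        rw [h3]
        simp only [map_add, Derivation.leibniz, map_three, d4, hD, smul_eq_mul]
        ring
      rw [e7, h3] at h6
      simp only [dBcoeff5, Delta1, d2, half_smul_two_mul, three_halves_smul_two_mul, he0]
      simp only [Fin.isValue] at h6 ⊢
      linear_combination e * h6 - D 5 B * he
    · have e5 : D 5 C = 4 * (D 5 μ * ν + μ * D 5 ν) - 3 * D 5 (D 7 ν) - D 5 (D 5 μ) := by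
        rw [h2]
        simp only [map_add, map_sub, Derivation.leibniz, map_three, d4, hD, smul_eq_mul]
        ring
      rw [e5, h2] at h4
      simp only [dBcoeff7, Delta1, d2, half_smul_two_mul, three_halves_smul_two_mul, he0]
      simp only [Fin.isValue] at h4 ⊢
      linear_combination h4
  · rintro ⟨r1, r2, r3, r4, r5⟩
    rw [formalD0_eq_iff] at r1 r2 r3
    have hμ := z2.1 r1.1
    have hν := z2.1 r2.1
    have Hμ := deriv_deriv_eq_zero hμ (i2 Hm)
    have Hν := deriv_deriv_eq_zero hν (i2 Hn)
    have h2 := r4.trans g4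
    have h3 := r5.trans g6
    obtain ⟨hB, hB5, hB7⟩ := r3
    have eC : ∀ j, D j C = 4 * (D j μ * ν + μ * D j ν) - 3 * D j (D 7 ν) - D j (D 5 μ) := by
      intro j
      rw [h2]
      simp only [map_add, map_sub, Derivation.leibniz, map_three, d4, hD, smul_eq_mul]
      ring
    have eF : ∀ j, D j F = 4 * (D j μ * ν + μ * D j ν) + D j (D 7 ν) + 3 * D j (D 5 μ) := by
      intro j
      rw [h3]
      simp only [map_add, Derivation.leibniz, map_three, d4, hD, smul_eq_mul]
      ring
    refine coframeIntegrable_halfTable D e μ ν B C F he hD hμ hν hB ?_ ?_ h2 h3 ?_ ?_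
    · intro j h5 h7
      rw [eC, hμ j h5 h7, hν j h5 h7, (Hμ j h5 h7).1, (Hν j h5 h7).2]
      ring
    · intro j h5 h7
      rw [eF, hμ j h5 h7, hν j h5 h7, (Hμ j h5 h7).1, (Hν j h5 h7).2]
      ring
    · rw [hB7, eC 5, h2]
      simp only [dBcoeff7, Delta1, d2, half_smul_two_mul, three_halves_smul_two_mul, he0]
      simp only [Fin.isValue]
      ring
    · rw [hB5, eF 7, h3]
      simp only [dBcoeff5, Delta1, d2, half_smul_two_mul, three_halves_smul_two_mul, he0]
      simp only [Fin.isValue]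
      linear_combination (-8 * μ * (4 * μ * ν + e) - 4 * ν * e * B - 24 * μ * D 5 μ
        - 4 * μ * D 0 ν + 4 * ν * D 0 μ + 3 * D 0 (D 5 μ) + D 0 (D 0 ν)) * he

end FormalPart

/-! ### Structure equations with a connection-like term wᵢ φ ∧ ωⁱ -/

section Twist

variable {A : Type*} [CommRing A] [Algebra ℝ A]

/-- `d²ωⁱ` for structure equations `dωⁱ = wᵢ φ ∧ ωⁱ + Rⁱ`, with `Rⁱ` homogeneous of
weight `wᵢ`. -/
theorem formalD2_twist (D : Fin 7 → Derivation ℝ A A) {γ R : Fin 7 → Fin 7 → Fin 7 → A}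
    {φ : Fin 7 → A}
    (hγ : ∀ i j k, γ i j k =
      (weight i : A) * (φ j * (if i = k then 1 else 0) - φ k * (if i = j then 1 else 0)) + R i j k)
    (hR : ∀ i j k, weight i ≠ weight j + weight k → R i j k = 0)
    (hs : ∀ i j k, R i k j = -R i j k) (i j k l : Fin 7) :
    formalD2 D γ (γ i) j k l =
      (weight i : A) * (formalD1 D γ φ j k * (if i = l then 1 else 0) +
        formalD1 D γ φ k l * (if i = j then 1 else 0) +
        formalD1 D γ φ l j * (if i = k then 1 else 0)) + formalD2 D R (R i) j k l := by
  -- Homogeneity: the term wᵢ φ ∧ Rⁱ from d(wᵢ φ ∧ ωⁱ) cancels against the term (wⱼ + wₖ) φ ∧ Rⁱ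
  -- from dRⁱ.
  have hom : ∀ j k, ((weight j : A) + weight k) * R i j k = weight i * R i j k := by
    intro j k
    by_cases h : weight i = weight j + weight k
    · rw [h]; push_cast; ring
    · rw [hR i j k h]; ring
  have s1 : ∀ j k, ∑ a, φ a * γ a j k =
      (weight k : A) * φ k * φ j - weight j * φ j * φ k + ∑ a, φ a * R a j k := by
    intro j k
    simp only [hγ, mul_add, mul_sub, Finset.sum_add_distrib, Finset.sum_sub_distrib, mul_ite,
      mul_one, mul_zero, Finset.sum_ite_eq', Finset.mem_univ, if_true]
    ring
  have s2 : ∀ j k l, ∑ a, γ a j k * γ i a l =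
      (weight k : A) * φ j * γ i k l - weight j * φ k * γ i j l
      + weight i * (if i = l then 1 else 0) * (∑ a, φ a * R a j k) - weight i * φ l * R i j k
      + ∑ a, R a j k * R i a l := by
    intro j k l
    have : ∀ a, γ a j k * γ i a l =
        ((if a = k then (weight a : A) * φ j * γ i a l else 0)
          - (if a = j then (weight a : A) * φ k * γ i a l else 0))
        + weight i * (if i = l then 1 else 0) * (φ a * R a j k)
        - (if i = a then weight i * φ l * R a j k else 0) + R a j k * R i a l := by
      intro a
      have e := hγ i a l
      rw [hγ a j k]
      split_ifs at e ⊢ <;> linear_combination R a j k * e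
    simp only [this, Finset.sum_add_distrib, Finset.sum_sub_distrib, Finset.sum_ite_eq',
      Finset.sum_ite_eq, Finset.mem_univ, if_true, ← Finset.mul_sum]
  have hd : ∀ j k l, D j (γ i k l) = (weight i : A) *
      (D j (φ k) * (if i = l then 1 else 0) - D j (φ l) * (if i = k then 1 else 0))
      + D j (R i k l) := by
    intro j k l
    have hw : D j (weight i : A) = 0 := by
      rw [show (weight i : A) = algebraMap ℝ A (weight i) by simp, (D j).map_algebraMap]
    rw [hγ]
    split_ifs <;> simp [Derivation.leibniz, hw]
  have hγs : ∀ j k, γ i k j = -γ i j k := by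
    intro j k
    rw [hγ, hγ, hs]; ring
  simp only [formalD2, formalD1, Finset.sum_add_distrib, s1, s2, hd]
  rw [hγs l j, hγs j k, hγs k l, hγ i j k, hγ i k l, hγ i l j]
  linear_combination φ j * hom k l + φ k * hom l j + φ l * hom j k

theorem reducedStructureEqs_of_twist (D : Fin 7 → Derivation ℝ A A)
    {γ R : Fin 7 → Fin 7 → Fin 7 → A} {φ : Fin 7 → A} {ε : ℝ} (hε : ε = 1 ∨ ε = -1)
    {m n a2 b2 a3 b3 a4 b4 a6 b6 B C F G : A}
    (hγ : ∀ i j k, γ i j k =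
      (weight i : A) * (φ j * (if i = k then 1 else 0) - φ k * (if i = j then 1 else 0)) + R i j k)
    (hR : ∀ i j k, weight i ≠ weight j + weight k → R i j k = 0)
    (hT : R = coeffTable (algebraMap ℝ A ε) m n a2 b2 a3 b3 a4 b4 a6 b6 B C F G)
    (h : CoframeIntegrable D γ) :
    ReducedStructureEqs formalWedge ε m n B C F (formalCoframe A) R ∧
      ∀ j k, formalD1 D γ φ j k = 0 := by
  have hs : ∀ i j k, R i k j = -R i j k := by
    rw [hT]; exact coeffTable_swap _ _ _ _ _ _ _ _ _ _ _ _ _ _ _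
  have hΦs : ∀ j k, formalD1 D γ φ k j = -formalD1 D γ φ j k := by
    intro j k
    have : ∀ i, γ i k j = -γ i j k := fun i => by rw [hγ, hγ, hs]; ring
    simp only [formalD1, this, mul_neg, Finset.sum_neg_distrib]
    ring
  have hD : ∀ j, D j (algebraMap ℝ A ε) = 0 := fun j => (D j).map_algebraMap ε
  have he : algebraMap ℝ A ε * algebraMap ℝ A ε = 1 := by
    rw [← map_mul]; rcases hε with rfl | rfl <;> simp
  have c : ∀ i j k l, (weight i : A) * (formalD1 D γ φ j k * (if i = l then 1 else 0) +
        formalD1 D γ φ k l * (if i = j then 1 else 0) +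
        formalD1 D γ φ l j * (if i = k then 1 else 0)) + formalD2 D R (R i) j k l = 0 :=
    fun i j k l => by rw [← formalD2_twist D hγ hR hs, h i]; rfl
  generalize formalD1 D γ φ = Φ at *
  clear h hγ hR
  generalize he0 : algebraMap ℝ A ε = e at *
  have r0 : R 0 = _ := (congrFun hT 0).trans (coeffTable_zero ..)
  have r1 : R 1 = _ := (congrFun hT 1).trans (coeffTable_one ..)
  have r2 : R 2 = _ := (congrFun hT 2).trans (coeffTable_two ..)
  have r3 : R 3 = _ := (congrFun hT 3).trans (coeffTable_three ..)
  have r4 : R 4 = _ := (congrFun hT 4).trans (coeffTable_four ..)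
  have r5 : R 5 = _ := (congrFun hT 5).trans (coeffTable_five ..)
  have r6 : R 6 = _ := (congrFun hT 6).trans (coeffTable_six ..)
  have w0 : weight 0 = 0 := rfl
  have w1 : weight 1 = 2 := rfl
  have w2 : weight 2 = 1 := rfl
  have w3 : weight 3 = 1 := rfl
  have w4 : weight 4 = 1 := rfl
  have w5 : weight 5 = 0 := rfl
  have w6 : weight 6 = 1 := rfl
  -- Components without dφ, since wᵢ = 0 or i is not among the three form indices. They determine
  -- the coefficients.
  have c0 := c 0 1 5 7
  have c5 := c 5 1 5 7
  have c1 := And.intro (c 1 2 4 5) <| And.intro (c 1 2 4 7) <| And.intro (c 1 3 5 6) (c 1 3 6 7)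
  have c2 := And.intro (c 2 4 5 7) (c 2 3 5 7)
  have c3 := And.intro (c 3 5 6 7) (c 3 2 5 7)
  have c6 := c 6 2 5 7
  -- Components containing ωⁱ: d²ω¹ yields dφ on pairs of indices other than 1, while d²ω² and d²ω³
  -- yield the pairs with index 1.
  have f1 := And.intro (c 1 2 3 1) <| And.intro (c 1 2 4 1) <| And.intro (c 1 2 5 1) <|
    And.intro (c 1 2 6 1) <| And.intro (c 1 2 7 1) <| And.intro (c 1 3 4 1) <|
    And.intro (c 1 3 5 1) <| And.intro (c 1 3 6 1) <| And.intro (c 1 3 7 1) <|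
    And.intro (c 1 4 5 1) <| And.intro (c 1 4 6 1) <| And.intro (c 1 4 7 1) <|
    And.intro (c 1 5 6 1) <| And.intro (c 1 5 7 1) (c 1 6 7 1)
  have f2 := And.intro (c 2 1 3 2) <| And.intro (c 2 1 4 2) <| And.intro (c 2 1 5 2) <|
    And.intro (c 2 1 6 2) (c 2 1 7 2)
  have f3 := c 3 1 2 3
  clear c
  simp only [r0, r1, r2, r3, r4, r5, r6] at c0 c1 c5 c2 c3 c6 f1 f2 f3
  simp only [formalD2, Fin.sum_univ_seven] at c0 c1 c5 c2 c3 c6 f1 f2 f3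
  simp only [Pi.add_apply, skew, Fin.isValue, Fin.reduceEq, and_true, and_false, if_true, if_false,
    map_zero, add_zero, zero_add, mul_zero, zero_mul, map_add, map_neg, Derivation.leibniz,
    smul_eq_mul, map_two, map_three, hD, Derivation.map_one_eq_zero, neg_zero,
    true_and, w0, w1, w2, w3, w4, w5, w6, Int.cast_zero, Int.cast_one, Int.cast_ofNat, mul_one]
    at c0 c1 c5 c2 c3 c6 f1 f2 f3
  simp only [r0, r1, r2, r3, r4, r5, r6, Pi.add_apply, skew, Fin.isValue, Fin.reduceEq, and_true,
    and_false, if_true, if_false, add_zero, zero_add, mul_zero, zero_mul, neg_zero,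
    true_and] at c0 c1 c5 c2 c3 c6 f1 f2 f3
  clear r0 r1 r2 r3 r4 r5 r6
  have z : ∀ {f : A}, 2 * f = 0 → f = 0 := eq_zero_of_two_mul_eq_zero
  have half : ∀ {x y : A}, 2 * x = y → x = (1 / 2 : ℝ) • y := by
    rintro x y rfl; rw [half_smul_two_mul]
  have half3 : ∀ {x y : A}, 2 * x = 3 * y → x = (3 / 2 : ℝ) • y := by
    intro x y h
    have h3 : (3 / 2 : ℝ) • y = (1 / 2 : ℝ) • (3 * y) := by
      rw [show (3 / 2 : ℝ) = 1 / 2 + 1 / 2 + 1 / 2 by norm_num, add_smul, add_smul,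
        show 3 * y = y + y + y by ring, smul_add, smul_add]
    rw [h3, ← h, half_smul_two_mul]
  obtain ⟨ha4, hb4, ha6, hb6⟩ := c1
  have ha4 : a4 = -a2 := by linear_combination -ha4
  have hb4 : b4 = -b2 := by linear_combination -hb4
  have ha6 : a6 = -a3 := by linear_combination ha6
  have hb6 : b6 = -b3 := by linear_combination -hb6
  subst ha4 hb4 ha6 hb6
  have hG : G = e * B := by linear_combination e * c6 - G * he
  have hb2 : b2 = (1 / 2 : ℝ) • m := half (by linear_combination c2.1)
  have hb3 : b3 = (3 / 2 : ℝ) • m := half3 (by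
    linear_combination 2 * e * c3.2 - (2 * b3 - 2 * b2 - 2 * m) * he + c2.1)
  have ha3' : 2 * -a3 = n := by linear_combination -c3.1
  have ha3 : -a3 = (1 / 2 : ℝ) • n := half ha3'
  have ha2 : -a2 = (3 / 2 : ℝ) • n := half3 (by linear_combination 2 * c2.2 + ha3')
  refine ⟨?_, ?_⟩
  · rw [reducedStructureEqs_formal_iff, hT, he0, ← hb2, ← hb3, ← ha3, ← ha2, neg_neg, neg_neg, hG]
  · have hlt : ∀ j k, j < k → Φ j k = 0 := by
      -- The (1,5) and (1,7) entries of dφ appear together with the ω¹-derivatives of a2 and b2,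
      -- which are multiples of n and m.
      have d2 : D 1 a2 = 0 := by
        rw [← neg_neg a2, ha2, map_neg, Derivation.map_smul, c0, smul_zero, neg_zero]
      have d3 : D 1 b2 = 0 := by rw [hb2, Derivation.map_smul, c5, smul_zero]
      obtain ⟨q23, q24, q25, q26, q20, q34, q35, q36, q30, q45, q46, q40, q56, q50, q60⟩ := f1
      simp only [d2, d3, one_mul, neg_zero, add_zero] at f2 f3
      obtain ⟨q13, q14, q15, q16, q10⟩ := f2
      have sw : ∀ {j k}, Φ k j = 0 → Φ j k = 0 := fun {j k} h => by rw [hΦs k j, h, neg_zero]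
      intro j k hjk
      fin_cases j <;> fin_cases k <;> first
        | exact absurd hjk (by decide)
        | assumption
        | exact z (by assumption)
        | exact sw (by assumption)
        | exact sw (z (by assumption))
    intro j k
    rcases lt_trichotomy j k with hjk | rfl | hjk
    · exact hlt j k hjk
    · exact z (by linear_combination hΦs j j)
    · rw [hΦs k j, hlt k j hjk, neg_zero]

end Twist

/-! ### From d² = 0 on functions to d² = 0 on the coframe -/

section Jacobi

variable {A : Type*} [CommRing A] [Algebra ℝ A]

/-- The Jacobi identity: if `d²` vanishes on all functions and the differentials of functions span
all 1-forms, then `d²ωⁱ = 0`. -/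
theorem coframeIntegrable_of_forall_functionIntegrable {D : Fin 7 → Derivation ℝ A A}
    {γ : Fin 7 → Fin 7 → Fin 7 → A} (hγ : ∀ i j k, γ i k j = -γ i j k)
    (h : ∀ f, FunctionIntegrable D γ f)
    (hD : ∀ c : Fin 7 → A, (∀ f, ∑ i, c i * D i f = 0) → c = 0) :
    CoframeIntegrable D γ := by
  have H : ∀ f j k, D j (D k f) - D k (D j f) + ∑ i, D i f * γ i j k = 0 := fun f j k =>
    congrFun (congrFun (h f) j) k
  have H1 : ∀ f j k l, D l (D j (D k f)) - D l (D k (D j f)) +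
      (∑ i, D i f * D l (γ i j k) + ∑ i, γ i j k * D l (D i f)) = 0 := by
    intro f j k l
    have := congrArg (D l) (H f j k)
    simpa only [map_add, map_sub, map_sum, map_zero, Derivation.leibniz, smul_eq_mul,
      Finset.sum_add_distrib] using this
  -- Exchanging D l with D i produces the quadratic terms γγ of d²ωᵃ.
  have H2 : ∀ f j k l, ∑ i, γ i j k * D l (D i f) =
      ∑ i, D i (D l f) * γ i j k + ∑ a, (∑ i, γ i j k * γ a i l) * D a f := by
    intro f j k l
    simp only [Finset.sum_mul]
    rw [Finset.sum_comm, ← Finset.sum_add_distrib]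
    refine Finset.sum_congr rfl fun i _ => ?_
    have e := H f l i
    have : ∑ a, γ i j k * γ a i l * D a f = -(γ i j k * ∑ a, D a f * γ a l i) := by
      rw [Finset.mul_sum, ← Finset.sum_neg_distrib]
      refine Finset.sum_congr rfl fun a _ => ?_
      rw [hγ a l i]; ring
    rw [this]
    linear_combination γ i j k * e
  intro i
  ext j k l
  refine congrFun (hD (fun i => formalD2 D γ (γ i) j k l) fun f => ?_) i
  have e : ∀ a, formalD2 D γ (γ a) j k l * D a f =
      (D a f * D l (γ a j k) + (∑ i, γ i j k * γ a i l) * D a f) +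
      (D a f * D j (γ a k l) + (∑ i, γ i k l * γ a i j) * D a f) +
      (D a f * D k (γ a l j) + (∑ i, γ i l j * γ a i k) * D a f) := by
    intro a
    simp only [formalD2, Finset.sum_add_distrib]
    ring
  simp only [e, Finset.sum_add_distrib]
  -- Summed cyclically, the third derivatives cancel as in the Jacobi identity for commutators, once
  -- the relation `H` for the functions D j f, D k f, D l f has been used on the second-order terms.
  -- What is left is ∑ (d²ωᵃ)ⱼₖₗ D a f = 0.
  have a1 := H1 f j k l
  have a2 := H1 f k l j
  have a3 := H1 f l j k
  rw [H2] at a1 a2 a3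
  linear_combination a1 + a2 + a3 - H (D k f) l j - H (D l f) j k - H (D j f) k l

end Jacobi

/-! ### The dual frame and commutators of coframe derivatives -/

section Frame

variable {V : Set E} {ω : Fin 7 → E → Covec} {x : E}

theorem differentiableAt_of_contDiffOn {F : Type*} [NormedAddCommGroup F] [NormedSpace ℝ F]
    {g : E → F} (hV : IsOpen V) (hg : ContDiffOn ℝ (⊤ : ℕ∞) g V) (hx : x ∈ V) :
    DifferentiableAt ℝ g x :=
  (hg.differentiableOn (by simp)).differentiableAt (hV.mem_nhds hx)

theorem extD_apply {α : E → Covec} (h : DifferentiableAt ℝ α x) (v w : E) :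
    extD α x v w = fderiv ℝ α x v w - fderiv ℝ α x w v := by
  have h' : DifferentiableAt ℝ
      (fun y => ContinuousAlternatingMap.ofSubsingleton ℝ E ℝ (0 : Fin 1) (α y)) x :=
    (ContinuousAlternatingMap.ofSubsingletonLIE (𝕜 := ℝ) (E := E) (F := ℝ)
      (0 : Fin 1)).toContinuousLinearEquiv
      |>.differentiableAt.comp x h
  have e : ∀ u v : E, fderiv ℝ (fun y => α y u) x v = fderiv ℝ α x v u := by
    intro u v
    rw [fderiv_clm_apply h (differentiableAt_const u)]
    simp
  rw [extD, extDeriv_apply h']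
  simp [Fin.sum_univ_two, e, Fin.removeNth, sub_eq_add_neg]

/-- `ContinuousLinearMap.inverse` is zero on non-invertible maps, so `dualFrame` is meaningful only
through this. Seven independent covectors span the dual space, so a vector annihilated by all of
them is zero. -/
theorem isInvertible_pi {α : Fin 7 → Covec} (h : LinearIndependent ℝ α) :
    (ContinuousLinearMap.pi α).IsInvertible := by
  have hspan : Submodule.span ℝ (Set.range α) = ⊤ := by
    refine h.span_eq_top_of_card_eq_finrank ?_
    rw [← (LinearMap.toContinuousLinearMap (𝕜 := ℝ) (E := E) (F' := ℝ)).finrank_eq]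
    rw [show Module.finrank ℝ (E →ₗ[ℝ] ℝ) = Module.finrank ℝ E from Subspace.dual_finrank_eq]
    simp
  have hinj : Function.Injective (ContinuousLinearMap.pi α : E →ₗ[ℝ] E) := by
    rw [← LinearMap.ker_eq_bot, LinearMap.ker_eq_bot']
    intro v hv
    have hv' : ∀ i, α i v = 0 := fun i => congrFun hv i
    have : ∀ β : Covec, β v = 0 := by
      intro β
      have hβ : β ∈ Submodule.span ℝ (Set.range α) := hspan ▸ Submodule.mem_top
      induction hβ using Submodule.span_induction with
      | mem β hβ => obtain ⟨i, rfl⟩ := hβ; exact hv' i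
      | zero => rfl
      | add β₁ β₂ _ _ h₁ h₂ => simp [h₁, h₂]
      | smul c β _ h => simp [h]
    ext i
    exact this (ContinuousLinearMap.proj i)
  exact ⟨(LinearEquiv.ofInjectiveEndo _ hinj).toContinuousLinearEquiv, by ext; rfl⟩

theorem coframe_dualFrame (hω : IsCoframeOn ω V) (hx : x ∈ V) (i j : Fin 7) :
    ω i x (dualFrame ω x j) = if i = j then 1 else 0 := by
  have := congrFun ((isInvertible_pi (hω.2 x hx)).self_apply_inverse (Pi.single j 1)) i
  rw [Pi.single_apply] at this
  exact this

theorem eq_sum_dualFrame (hω : IsCoframeOn ω V) (hx : x ∈ V) (v : E) :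
    v = ∑ j, ω j x v • dualFrame ω x j := by
  refine (isInvertible_pi (hω.2 x hx)).injective ?_
  ext i
  simp [coframe_dualFrame hω hx]

theorem ext_dualFrame (hω : IsCoframeOn ω V) (hx : x ∈ V) {F : Type*} [AddCommGroup F] [Module ℝ F]
    {f g : E →ₗ[ℝ] F} (h : ∀ j, f (dualFrame ω x j) = g (dualFrame ω x j)) : f = g := by
  refine LinearMap.ext fun v => ?_
  rw [eq_sum_dualFrame hω hx v]
  simp [h]

theorem contDiffOn_dualFrame (hω : IsCoframeOn ω V) (j : Fin 7) :
    ContDiffOn ℝ (⊤ : ℕ∞) (fun x => dualFrame ω x j) V := by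
  intro x hx
  have h1 : ContDiffWithinAt ℝ (⊤ : ℕ∞) (fun x => ContinuousLinearMap.pi (fun i => ω i x)) V x := by
    have : ContDiffOn ℝ (⊤ : ℕ∞) (fun x => ContinuousLinearMap.pi (fun i => ω i x)) V :=
      contDiffOn_clm_apply.2 fun v =>
        contDiffOn_pi.2 fun i => (hω.1 i).clm_apply contDiffOn_const
    exact this x hx
  have h2 := (isInvertible_pi (hω.2 x hx)).contDiffAt_map_inverse (n := (⊤ : ℕ∞))
  exact (h2.comp_contDiffWithinAt x h1).clm_apply contDiffWithinAt_const

theorem contDiffOn_coframeDeriv (hV : IsOpen V) (hω : IsCoframeOn ω V) (j : Fin 7) {g : E → ℝ}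
    (hg : ContDiffOn ℝ (⊤ : ℕ∞) g V) : ContDiffOn ℝ (⊤ : ℕ∞) (coframeDeriv ω j g) V :=
  (hg.fderiv_of_isOpen hV (by simp)).clm_apply (contDiffOn_dualFrame hω j)

theorem structureCoeff_eq (hV : IsOpen V) (hω : IsCoframeOn ω V) (hx : x ∈ V) (i j k : Fin 7) :
    structureCoeff ω x i j k = fderiv ℝ (ω i) x (dualFrame ω x j) (dualFrame ω x k)
      - fderiv ℝ (ω i) x (dualFrame ω x k) (dualFrame ω x j) :=
  extD_apply (differentiableAt_of_contDiffOn hV (hω.1 i) hx) _ _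

theorem structureCoeff_swap (hV : IsOpen V) (hω : IsCoframeOn ω V) (hx : x ∈ V) (i j k : Fin 7) :
    structureCoeff ω x i k j = -structureCoeff ω x i j k := by
  rw [structureCoeff_eq hV hω hx, structureCoeff_eq hV hω hx]; ring

theorem contDiffOn_structureCoeff (hV : IsOpen V) (hω : IsCoframeOn ω V) (i j k : Fin 7) :
    ContDiffOn ℝ (⊤ : ℕ∞) (fun x => structureCoeff ω x i j k) V := by
  have h : ∀ j k, ContDiffOn ℝ (⊤ : ℕ∞)
      (fun x => fderiv ℝ (ω i) x (dualFrame ω x j) (dualFrame ω x k)) V := fun j k =>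
    (((hω.1 i).fderiv_of_isOpen hV (by simp)).clm_apply (contDiffOn_dualFrame hω j)).clm_apply
      (contDiffOn_dualFrame hω k)
  exact ((h j k).sub (h k j)).congr fun x hx => structureCoeff_eq hV hω hx i j k

/-- The commutators of the dual frame. -/
theorem coframe_bracket (hV : IsOpen V) (hω : IsCoframeOn ω V) (hx : x ∈ V) (i j k : Fin 7) :
    ω i x (fderiv ℝ (fun y => dualFrame ω y k) x (dualFrame ω x j)
      - fderiv ℝ (fun y => dualFrame ω y j) x (dualFrame ω x k)) = -structureCoeff ω x i j k := by
  have hd : ∀ k, DifferentiableAt ℝ (fun y => dualFrame ω y k) x := fun k =>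
    differentiableAt_of_contDiffOn hV (contDiffOn_dualFrame hω k) hx
  have hωd := differentiableAt_of_contDiffOn hV (hω.1 i) hx
  have key : ∀ k v, fderiv ℝ (ω i) x v (dualFrame ω x k)
      + ω i x (fderiv ℝ (fun y => dualFrame ω y k) x v) = 0 := by
    intro k v
    have h1 : fderiv ℝ (fun y => ω i y (dualFrame ω y k)) x v = 0 := by
      have : (fun y => ω i y (dualFrame ω y k)) =ᶠ[nhds x] fun _ => if i = k then 1 else 0 := by
        filter_upwards [hV.mem_nhds hx] with y hy
        exact coframe_dualFrame hω hy i k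
      rw [this.fderiv_eq]; simp
    rw [fderiv_clm_apply hωd (hd k)] at h1
    simpa [add_comm] using h1
  rw [structureCoeff_eq hV hω hx, map_sub]
  linear_combination key k (dualFrame ω x j) - key j (dualFrame ω x k)

/-- This is d²g = 0 in components. Symmetry of the second derivative leaves only the bracket of the
frame vectors, whose components are -γ. -/
theorem coframeDeriv_comm (hV : IsOpen V) (hω : IsCoframeOn ω V) (hx : x ∈ V) {g : E → ℝ}
    (hg : ContDiffOn ℝ (⊤ : ℕ∞) g V) (j k : Fin 7) :
    coframeDeriv ω j (coframeDeriv ω k g) x - coframeDeriv ω k (coframeDeriv ω j g) x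
      + ∑ i, coframeDeriv ω i g x * structureCoeff ω x i j k = 0 := by
  have hd : ∀ k, DifferentiableAt ℝ (fun y => dualFrame ω y k) x := fun k =>
    differentiableAt_of_contDiffOn hV (contDiffOn_dualFrame hω k) hx
  have hg' := differentiableAt_of_contDiffOn hV (hg.fderiv_of_isOpen hV (by simp) :
    ContDiffOn ℝ (⊤ : ℕ∞) (fderiv ℝ g) V) hx
  have e : ∀ j k, coframeDeriv ω j (coframeDeriv ω k g) x =
      fderiv ℝ g x (fderiv ℝ (fun y => dualFrame ω y k) x (dualFrame ω x j))
      + fderiv ℝ (fderiv ℝ g) x (dualFrame ω x j) (dualFrame ω x k) := by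
    intro j k
    rw [coframeDeriv, show coframeDeriv ω k g = fun y => fderiv ℝ g y (dualFrame ω y k) from rfl,
      fderiv_clm_apply hg' (hd k)]
    simp
  have sym : IsSymmSndFDerivAt ℝ g x :=
    (hg.contDiffAt (hV.mem_nhds hx)).isSymmSndFDerivAt
      (by
        rw [minSmoothness_of_isRCLikeNormedField]
        exact WithTop.coe_le_coe.2 (le_top : (2 : ℕ∞) ≤ ⊤))
  have b := eq_sum_dualFrame hω hx (fderiv ℝ (fun y => dualFrame ω y k) x (dualFrame ω x j)
      - fderiv ℝ (fun y => dualFrame ω y j) x (dualFrame ω x k))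
  have b' := congrArg (fderiv ℝ g x) b
  simp only [coframe_bracket hV hω hx, map_sub, map_sum, map_smul, smul_eq_mul, neg_mul,
    Finset.sum_neg_distrib] at b'
  rw [e, e, sym.eq (dualFrame ω x j)]
  have : ∑ i, coframeDeriv ω i g x * structureCoeff ω x i j k =
      ∑ i, structureCoeff ω x i j k * fderiv ℝ g x (dualFrame ω x i) :=
    Finset.sum_congr rfl fun i _ => mul_comm _ _
  rw [this]
  linear_combination b'

theorem coframeDeriv_congr (hV : IsOpen V) (hx : x ∈ V) {g h : E → ℝ} (hgh : Set.EqOn g h V)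
    (j : Fin 7) : coframeDeriv ω j g x = coframeDeriv ω j h x := by
  rw [coframeDeriv, coframeDeriv, (hgh.eventuallyEq_of_mem (hV.mem_nhds hx)).fderiv_eq]

end Frame

/-! ### Smooth functions on an open set as an algebra with seven derivations -/

section SmoothFunctions

variable {V : Set E} {ω : Fin 7 → E → Covec} {x : E}

theorem extend_apply (f : V → ℝ) (hx : x ∈ V) :
    Function.extend Subtype.val f 0 x = f ⟨x, hx⟩ :=
  Subtype.val_injective.extend_apply f 0 ⟨x, hx⟩

/-- The algebra of smooth functions on `V`. -/
def smoothFunctions (V : Set E) : Subalgebra ℝ (V → ℝ) where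
  -- Functions on the subtype are used so that agreement on V is equality in the algebra. The
  -- extension by zero only serves to speak of derivatives.
  carrier := {f | ContDiffOn ℝ (⊤ : ℕ∞) (Function.extend Subtype.val f 0) V}
  mul_mem' {f g} hf hg := (ContDiffOn.mul hf hg).congr fun x hx => by
    simp only [extend_apply _ hx, Pi.mul_apply]
  add_mem' {f g} hf hg := (ContDiffOn.add hf hg).congr fun x hx => by
    simp only [extend_apply _ hx, Pi.add_apply]
  algebraMap_mem' r := (contDiffOn_const (c := r)).congr fun x hx => by
    simp only [extend_apply _ hx, Pi.algebraMap_apply, Algebra.algebraMap_self, RingHom.id_apply]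

/-- The restriction to `V` of a function that is smooth on `V`. -/
noncomputable def restrictSmooth (g : E → ℝ) (hg : ContDiffOn ℝ (⊤ : ℕ∞) g V) : smoothFunctions V :=
  ⟨fun x => g x, hg.congr fun x hx => by rw [extend_apply _ hx]⟩

/-- An extension by zero. -/
noncomputable def extendZero (f : smoothFunctions V) : E → ℝ := Function.extend Subtype.val f.1 0

theorem contDiffOn_extendZero (f : smoothFunctions V) :
    ContDiffOn ℝ (⊤ : ℕ∞) (extendZero f) V := f.2

theorem extendZero_restrictSmooth {g : E → ℝ} (hg : ContDiffOn ℝ (⊤ : ℕ∞) g V) :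
    Set.EqOn (extendZero (restrictSmooth g hg)) g V := fun _ hx => extend_apply _ hx

theorem smoothFunctions_ext {f g : smoothFunctions V}
    (h : ∀ x (hx : x ∈ V), f.1 ⟨x, hx⟩ = g.1 ⟨x, hx⟩) :
    f = g := Subtype.ext (funext fun x => h x.1 x.2)

theorem extendZero_apply (f : smoothFunctions V) (hx : x ∈ V) :
    extendZero f x = f.1 ⟨x, hx⟩ := extend_apply _ hx

/-- The coframe derivatives, as derivations of the algebra of smooth functions. -/
noncomputable def frameDerivation (hV : IsOpen V) (hω : IsCoframeOn ω V) (j : Fin 7) :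
    Derivation ℝ (smoothFunctions V) (smoothFunctions V) :=
  Derivation.mk'
    { toFun := fun f => restrictSmooth (coframeDeriv ω j (extendZero f))
        (contDiffOn_coframeDeriv hV hω j (contDiffOn_extendZero f))
      map_add' := fun f g => smoothFunctions_ext fun x hx => by
        have hf := differentiableAt_of_contDiffOn hV (contDiffOn_extendZero f) hx
        have hg := differentiableAt_of_contDiffOn hV (contDiffOn_extendZero g) hx
        change coframeDeriv ω j (extendZero (f + g)) x =
          coframeDeriv ω j (extendZero f) x + coframeDeriv ω j (extendZero g) x
        rw [coframeDeriv_congr hV hx (h := extendZero f + extendZero g) (fun y hy => by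
          simp only [extendZero_apply _ hy, Pi.add_apply]; rfl)]
        simp [coframeDeriv, fderiv_add hf hg]
      map_smul' := fun c f => smoothFunctions_ext fun x hx => by
        have hf := differentiableAt_of_contDiffOn hV (contDiffOn_extendZero f) hx
        change coframeDeriv ω j (extendZero (c • f)) x = c * coframeDeriv ω j (extendZero f) x
        rw [coframeDeriv_congr hV hx (h := c • extendZero f) (fun y hy => by
          simp only [extendZero_apply _ hy, Pi.smul_apply]; rfl)]
        simp [coframeDeriv, fderiv_const_smul hf] }
    fun f g => smoothFunctions_ext fun x hx => by
        have hf := differentiableAt_of_contDiffOn hV (contDiffOn_extendZero f) hx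
        have hg := differentiableAt_of_contDiffOn hV (contDiffOn_extendZero g) hx
        change coframeDeriv ω j (extendZero (f * g)) x =
          f.1 ⟨x, hx⟩ * coframeDeriv ω j (extendZero g) x +
            g.1 ⟨x, hx⟩ * coframeDeriv ω j (extendZero f) x
        rw [coframeDeriv_congr hV hx (h := extendZero f * extendZero g) (fun y hy => by
          simp only [extendZero_apply _ hy, Pi.mul_apply]; rfl)]
        simp [coframeDeriv, fderiv_mul hf hg, extendZero_apply _ hx]

theorem frameDerivation_restrictSmooth (hV : IsOpen V) (hω : IsCoframeOn ω V) (j : Fin 7)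
    {g : E → ℝ} (hg : ContDiffOn ℝ (⊤ : ℕ∞) g V) :
    frameDerivation hV hω j (restrictSmooth g hg) =
      restrictSmooth (coframeDeriv ω j g) (contDiffOn_coframeDeriv hV hω j hg) :=
  smoothFunctions_ext fun _ hx => coframeDeriv_congr hV hx (extendZero_restrictSmooth hg) j

theorem smoothFunctions_extendZero (f : smoothFunctions V) :
    restrictSmooth (extendZero f) (contDiffOn_extendZero f) = f :=
  smoothFunctions_ext fun _ hx => extendZero_apply f hx

/-- The structure functions, as elements of the algebra of smooth functions. -/
noncomputable def smoothStructureCoeff (hV : IsOpen V) (hω : IsCoframeOn ω V) (i j k : Fin 7) :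
    smoothFunctions V :=
  restrictSmooth (fun x => structureCoeff ω x i j k) (contDiffOn_structureCoeff hV hω i j k)

theorem functionIntegrable_smoothFunctions (hV : IsOpen V) (hω : IsCoframeOn ω V)
    (f : smoothFunctions V) :
    FunctionIntegrable (frameDerivation hV hω) (smoothStructureCoeff hV hω) f := by
  rw [← smoothFunctions_extendZero f]
  ext j k : 2
  simp only [formalD1, formalD0, frameDerivation_restrictSmooth]
  refine smoothFunctions_ext fun x hx => ?_
  have := coframeDeriv_comm hV hω hx (contDiffOn_extendZero f) j k
  simpa [smoothStructureCoeff, restrictSmooth] using this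

/-- Coordinate functions show that differentials span: their coframe derivatives are the coordinates
of the dual frame vectors, which are independent. -/
theorem coframeIntegrable_smoothFunctions (hV : IsOpen V) (hω : IsCoframeOn ω V) :
    CoframeIntegrable (frameDerivation hV hω) (smoothStructureCoeff hV hω) := by
  refine coframeIntegrable_of_forall_functionIntegrable ?_
    (functionIntegrable_smoothFunctions hV hω) ?_
  · intro i j k
    exact smoothFunctions_ext fun x hx => structureCoeff_swap hV hω hx i j k
  · intro c hc
    ext j : 1
    refine smoothFunctions_ext fun x hx => ?_
    have h0 : ∑ i, (c i).1 ⟨x, hx⟩ • dualFrame ω x i = 0 := by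
      ext p
      have hp : ContDiffOn ℝ (⊤ : ℕ∞) (fun y : E => y p) V :=
        (ContinuousLinearMap.proj (R := ℝ) (φ := fun _ : Fin 7 => ℝ) p).contDiff.contDiffOn
      have h1 := hc (restrictSmooth _ hp)
      simp only [frameDerivation_restrictSmooth] at h1
      have h2 := congrArg (fun f : smoothFunctions V => f.1 ⟨x, hx⟩) h1
      have h3 : ∀ i, coframeDeriv ω i (fun y : E => y p) x = dualFrame ω x i p := by
        intro i
        have := (ContinuousLinearMap.proj (R := ℝ) (φ := fun _ : Fin 7 => ℝ) p).hasFDerivAt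
          (x := x)
        exact congrArg (fun L : Covec => L (dualFrame ω x i)) this.fderiv
      simpa [restrictSmooth, h3] using h2
    have h1 := congrArg (ω j x) h0
    simpa [coframe_dualFrame hω hx] using h1

end SmoothFunctions

/-! ### Absorption and the vanishing of torsion of nonzero weight -/

section Torsion

/-- The absorption parameter that normalizes `γ¹ⱼ₁` (for `j ≠ 1`) and `γ²₁₂` to zero. -/
noncomputable def absorbingParameter (T : Fin 7 → Fin 7 → Fin 7 → ℝ) : Fin 7 → ℝ :=
  fun j => if j = 1 then T 2 1 2 else 1 / 2 * T 1 j 1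

/-- The torsion that remains after absorption. -/
noncomputable def reducedTorsion (T : Fin 7 → Fin 7 → Fin 7 → ℝ) : Fin 7 → Fin 7 → Fin 7 → ℝ :=
  T - absorption (absorbingParameter T)

/-- A component of the remaining torsion, as a linear functional. -/
noncomputable def torsionComponent (i j k : Fin 7) : (Fin 7 → Fin 7 → Fin 7 → ℝ) →ₗ[ℝ] ℝ where
  toFun T := reducedTorsion T i j k
  map_add' S T := by
    simp only [reducedTorsion, absorption, absorbingParameter, Pi.sub_apply, Pi.add_apply]
    split_ifs <;> ring
  map_smul' c T := by
    simp only [reducedTorsion, absorption, absorbingParameter, Pi.sub_apply, Pi.smul_apply,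
      smul_eq_mul, RingHom.id_apply]
    split_ifs <;> ring

/-- The factor 1/2 compensates w₁ = 2. The parameter λ₁ must be read off from γ²₁₂, as γ¹₁₁ does not
see it. Having a left inverse of absorption makes every component of `reducedTorsion` a torsion
coefficient. -/
theorem absorbingParameter_absorption (lam : Fin 7 → ℝ) :
    absorbingParameter (absorption lam) = lam := by
  have w1 : weight 1 = 2 := rfl
  have w2 : weight 2 = 1 := rfl
  ext j
  simp only [absorbingParameter, absorption, w1, w2]
  by_cases h : j = 1
  · simp [h]
  · simp [h, Ne.symm h]

theorem isTorsionCoeff_torsionComponent (i j k : Fin 7) :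
    IsTorsionCoeff (torsionComponent i j k) := fun lam => by
  change reducedTorsion (absorption lam) i j k = 0
  rw [reducedTorsion, absorbingParameter_absorption, sub_self]
  rfl

/-- Absorption is equivariant: λⱼ scales like the entries γⁱⱼᵢ that it corrects. -/
theorem absorbingParameter_scaleCoeff (a : ℝ) (T : Fin 7 → Fin 7 → Fin 7 → ℝ)
    (j : Fin 7) :
    absorbingParameter (scaleCoeff a T) j = a ^ (-weight j) * absorbingParameter T j := by
  simp only [absorbingParameter, scaleCoeff]
  split_ifs with h
  · rw [h]; rfl
  · rw [show weight 1 - weight j - weight 1 = -weight j by ring]; ring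

theorem hasScalingWeight_torsionComponent (i j k : Fin 7) :
    HasScalingWeight (torsionComponent i j k) (weight i - weight j - weight k) := by
  intro a _ T
  change reducedTorsion (scaleCoeff a T) i j k = _ * reducedTorsion T i j k
  simp only [reducedTorsion, Pi.sub_apply, absorption, absorbingParameter_scaleCoeff]
  simp only [scaleCoeff]
  by_cases h1 : i = k <;> by_cases h2 : i = j
  · subst h1; subst h2; simp
  · subst h1
    rw [show weight i - weight j - weight i = -weight j by ring]
    simp [h2]; ring
  · subst h2
    rw [show weight i - weight i - weight k = -weight k by ring]
    simp [h1]; ring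
  · simp [h1, h2]

theorem reducedTorsion_eq_zero {U : Set E} {ω : Fin 7 → E → Covec}
    (h1 : NontrivialTorsionConstant ω U) (h2 : ¬ ReducibleToIdentity ω U) {x : E} (hx : x ∈ U)
    (i j k : Fin 7) (hw : weight i ≠ weight j + weight k) :
    reducedTorsion (structureCoeff ω x) i j k = 0 := by
  have hp : weight i - weight j - weight k ≠ 0 := fun h => hw (by linarith)
  obtain ⟨r, hr⟩ := h1 (torsionComponent i j k) _ (isTorsionCoeff_torsionComponent i j k)
    (hasScalingWeight_torsionComponent i j k) hp
  by_cases h0 : r = 0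
  · rw [← h0]; exact hr x hx
  -- The function a = 1 already normalizes the component to r ≠ 0, and tᵖ = 1 with p ≠ 0 and t > 0
  -- forces t = 1.
  · refine absurd ⟨torsionComponent i j k, _, fun _ => 1, r, isTorsionCoeff_torsionComponent i j k,
      hasScalingWeight_torsionComponent i j k, contDiffOn_const, fun _ _ => one_pos, ?_, ?_⟩ h2
    · intro y hy
      rw [← hr y hy]
      congr 1
      ext i j k
      simp [scaleCoeff]
    · intro t ht h
      have h' : t ^ (weight i - weight j - weight k) = 1 := by
        have := mul_right_cancel₀ h0 (h.trans (one_mul r).symm)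
        exact this
      by_contra hne
      exact hp ((zpow_eq_one_iff_right₀ ht.le hne).1 h')

end Torsion

/-! ### The torsion that can remain -/

section Table

variable {U : Set E} {ω : Fin 7 → E → Covec} {x : E}

theorem wedge_dualFrame (hω : IsCoframeOn ω U) (hx : x ∈ U) {p q : Fin 7} (hpq : p ≠ q)
    (j k : Fin 7) :
    wedge (ω p x) (ω q x) (dualFrame ω x j) (dualFrame ω x k) = skew p q 1 j k := by
  rw [← formalWedge_formalCoframe hpq]
  simp only [wedge, coframe_dualFrame hω hx, formalWedge, formalCoframe, Pi.single_apply,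
    eq_comm (a := p), eq_comm (a := q)]

theorem structureCoeff_of_congrMod (hω : IsCoframeOn ω U) (hx : x ∈ U) {i : Fin 7}
    {S : Finset (Fin 7)} {Ψ : E → E → E → ℝ} (h : CongrMod ω U S (extD (ω i)) Ψ) {j k : Fin 7}
    (hj : j ∉ S) (hk : k ∉ S) :
    structureCoeff ω x i j k = Ψ x (dualFrame ω x j) (dualFrame ω x k) := by
  obtain ⟨η, hη⟩ := h
  have hz : ∀ l ∈ S,
      wedge (η l x) (ω l x) (dualFrame ω x j) (dualFrame ω x k) = 0 := by
    intro l hl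
    simp [wedge, coframe_dualFrame hω hx, show l ≠ j from fun h => hj (h ▸ hl),
      show l ≠ k from fun h => hk (h ▸ hl)]
  rw [structureCoeff, hη x hx]
  simp only [Pi.add_apply, Finset.sum_apply]
  rw [Finset.sum_eq_zero hz, add_zero]

theorem reducedTorsion_of_ne (T : Fin 7 → Fin 7 → Fin 7 → ℝ) {i j k : Fin 7} (hj : i ≠ j)
    (hk : i ≠ k) : reducedTorsion T i j k = T i j k := by
  simp [reducedTorsion, absorption, hj, hk]

/-- Each entry outside the fourteen unknown ones is fixed by its nonzero weight, by a congruence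
(absorption changes only entries with i = j or i = k), or by the normalization of γ¹ⱼ₁. -/
theorem reducedTorsion_eq_coeffTable {ε : ℝ} (hU : IsOpen U) (hω : IsCoframeOn ω U)
    (hg : GenericHyperbolicOn ε ω U) (hx : x ∈ U) {R : Fin 7 → Fin 7 → Fin 7 → ℝ}
    (hR : R = reducedTorsion (structureCoeff ω x))
    (hw : ∀ i j k, weight i ≠ weight j + weight k → R i j k = 0) :
    R = coeffTable ε (R 5 5 7) (R 7 5 7) (R 2 2 5) (R 2 2 7) (R 3 3 5) (R 3 3 7) (R 4 4 5)
      (R 4 4 7) (R 6 6 5) (R 6 6 7) (R 4 2 5) (R 4 2 7) (R 6 3 5) (R 6 3 7) := by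
  have hs : ∀ i j k, R i k j = -R i j k := by
    intro i j k
    simp only [hR, reducedTorsion, Pi.sub_apply, absorption, structureCoeff_swap hU hω hx i j k]
    ring
  have h1 : ∀ j k, j ∉ ({1} : Finset (Fin 7)) → k ∉ ({1} : Finset (Fin 7)) →
      1 ≠ j → 1 ≠ k → R 1 j k = skew 3 6 1 j k + skew 2 4 1 j k := by
    intro j k hj hk hj' hk'
    rw [hR, reducedTorsion_of_ne _ hj' hk', structureCoeff_of_congrMod hω hx hg.d1 hj hk]
    simp (disch := decide) only [Pi.add_apply, wedge_dualFrame hω hx]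
  have h2 : ∀ j k, j ∉ ({1, 2} : Finset (Fin 7)) → k ∉ ({1, 2} : Finset (Fin 7)) →
      2 ≠ j → 2 ≠ k → R 2 j k = skew 4 5 1 j k + skew 3 7 1 j k := by
    intro j k hj hk hj' hk'
    rw [hR, reducedTorsion_of_ne _ hj' hk', structureCoeff_of_congrMod hω hx hg.d2 hj hk]
    simp (disch := decide) only [Pi.add_apply, wedge_dualFrame hω hx]
  have h3 : ∀ j k, j ∉ ({1, 3} : Finset (Fin 7)) → k ∉ ({1, 3} : Finset (Fin 7)) →
      3 ≠ j → 3 ≠ k → R 3 j k = skew 6 7 1 j k + ε * skew 2 5 1 j k := by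
    intro j k hj hk hj' hk'
    rw [hR, reducedTorsion_of_ne _ hj' hk', structureCoeff_of_congrMod hω hx hg.d3 hj hk]
    simp (disch := decide) only [Pi.add_apply, Pi.smul_apply, smul_eq_mul, wedge_dualFrame hω hx]
  have h4 : ∀ j k, j ∉ ({1, 2, 4} : Finset (Fin 7)) → k ∉ ({1, 2, 4} : Finset (Fin 7)) →
      4 ≠ j → 4 ≠ k → R 4 j k = ε * skew 5 6 1 j k := by
    intro j k hj hk hj' hk'
    rw [hR, reducedTorsion_of_ne _ hj' hk', structureCoeff_of_congrMod hω hx hg.d4 hj hk]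
    simp (disch := decide) only [Pi.smul_apply, smul_eq_mul, wedge_dualFrame hω hx]
  have h6 : ∀ j k, j ∉ ({1, 3, 6} : Finset (Fin 7)) → k ∉ ({1, 3, 6} : Finset (Fin 7)) →
      6 ≠ j → 6 ≠ k → R 6 j k = -skew 4 7 1 j k := by
    intro j k hj hk hj' hk'
    rw [hR, reducedTorsion_of_ne _ hj' hk', structureCoeff_of_congrMod hω hx hg.d6 hj hk]
    simp (disch := decide) only [Pi.neg_apply, wedge_dualFrame hω hx]
  have hz : ∀ j, j ≠ 1 → R 1 j 1 = 0 := by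
    intro j hj
    have w1 : (weight 1 : ℝ) = 2 := by norm_num [show weight 1 = 2 from rfl]
    simp [hR, reducedTorsion, absorption, absorbingParameter, w1, hj, Ne.symm hj]
  clear hR
  have key : ∀ i j k, j < k → R i j k =
      coeffTable ε (R 5 5 7) (R 7 5 7) (R 2 2 5) (R 2 2 7) (R 3 3 5) (R 3 3 7) (R 4 4 5)
      (R 4 4 7) (R 6 6 5) (R 6 6 7) (R 4 2 5) (R 4 2 7) (R 6 3 5) (R 6 3 7) i j k := by
    intro i
    fin_cases i <;> simp only [Fin.reduceFinMk, Fin.zero_eta, Fin.mk_one, coeffTable_zero,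
      coeffTable_one, coeffTable_two, coeffTable_three, coeffTable_four, coeffTable_five,
      coeffTable_six] <;>
    intro j k hjk <;> fin_cases j <;> fin_cases k <;>
    first
    | exact absurd hjk (by decide)
    | (simp only [Fin.reduceFinMk, Fin.zero_eta, Fin.mk_one, Pi.add_apply, skew, Fin.isValue,
        Fin.reduceEq, and_true, and_false, if_true, if_false, add_zero, zero_add]; done)
    | (simp only [Fin.reduceFinMk, Fin.zero_eta, Fin.mk_one, Pi.add_apply, skew, Fin.isValue,
        Fin.reduceEq, and_true, and_false, if_true, if_false, add_zero, zero_add]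
       first
       -- As 7 is 0 in `Fin 7`, a parameter such as R 2 2 7 occurs with its lower indices swapped
       -- when j < k.
       | exact hs _ _ _
       | exact hw _ _ _ (by decide)
       | (simp (disch := decide) only [h1, h2, h3, h4, h6, skew, Fin.isValue,
            Fin.reduceEq, and_true, and_false, if_true, if_false, add_zero, zero_add, mul_one,
            mul_zero, neg_zero, mul_neg, neg_neg])
       | exact hz _ (by decide)
       | exact (hs _ _ _).trans (neg_eq_zero.2 (hz _ (by decide))))
  ext i j k
  rcases lt_trichotomy j k with h | rfl | h
  · exact key i j k h
  · have e1 := hs i j j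
    have e2 := coeffTable_swap ε (R 5 5 7) (R 7 5 7) (R 2 2 5) (R 2 2 7) (R 3 3 5) (R 3 3 7)
      (R 4 4 5) (R 4 4 7) (R 6 6 5) (R 6 6 7) (R 4 2 5) (R 4 2 7) (R 6 3 5) (R 6 3 7) i j j
    linarith
  · rw [hs i k j, key i k j h, ← coeffTable_swap]

end Table

/-! ### Passing between smooth functions, values at a point, and forms -/

section Evaluation

variable {V : Set E} {x : E}

theorem coeffTable_map {A B : Type*} [CommRing A] [CommRing B] (f : A →+* B)
    (e m n a2 b2 a3 b3 a4 b4 a6 b6 b c d g : A) (i j k : Fin 7) :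
    f (coeffTable e m n a2 b2 a3 b3 a4 b4 a6 b6 b c d g i j k) =
      coeffTable (f e) (f m) (f n) (f a2) (f b2) (f a3) (f b3) (f a4) (f b4) (f a6) (f b6) (f b)
        (f c) (f d) (f g) i j k := by
  have hs : ∀ (p q : Fin 7) (t : A), f (skew p q t j k) = skew p q (f t) j k := by
    intro p q t
    simp only [skew]
    split_ifs <;> simp
  fin_cases i <;> simp only [Fin.reduceFinMk, Fin.zero_eta, Fin.mk_one, coeffTable_zero,
      coeffTable_one, coeffTable_two, coeffTable_three, coeffTable_four, coeffTable_five,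
      coeffTable_six, Pi.add_apply, map_add, hs, map_one, map_neg]

/-- Evaluation at a point of `V`. -/
def evalAt (hx : x ∈ V) : smoothFunctions V →ₐ[ℝ] ℝ :=
  (Pi.evalAlgHom ℝ (fun _ : V => ℝ) ⟨x, hx⟩).comp (smoothFunctions V).val

theorem reducedStructureEqs_smooth_iff {ε : ℝ} {m n B C F : smoothFunctions V}
    {γ : Fin 7 → Fin 7 → Fin 7 → smoothFunctions V} :
    ReducedStructureEqs formalWedge ε m n B C F (formalCoframe (smoothFunctions V)) γ ↔
      ∀ x (hx : x ∈ V), ReducedStructureEqs formalWedge ε (evalAt hx m) (evalAt hx n)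
        (evalAt hx B) (evalAt hx C) (evalAt hx F) (formalCoframe ℝ)
        (fun i j k => evalAt hx (γ i j k)) := by
  simp only [reducedStructureEqs_formal_iff]
  constructor
  · rintro rfl x hx
    ext i j k
    rw [show evalAt hx _ = (evalAt hx : smoothFunctions V →+* ℝ) _ from rfl, coeffTable_map]
    simp
  · intro h
    ext i j k : 3
    refine smoothFunctions_ext fun x hx => ?_
    change evalAt hx (γ i j k) = evalAt hx _
    rw [show evalAt hx (coeffTable _ _ _ _ _ _ _ _ _ _ _ _ _ _ _ i j k) =
      (evalAt hx : smoothFunctions V →+* ℝ) _ from rfl, coeffTable_map,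
      congrFun (congrFun (congrFun (h x hx) i) j) k]
    simp

/-- The equations use only linear operations and the wedge product, so linear maps compatible with
the wedge transport them. This carries them from components to actual covectors. -/
theorem ReducedStructureEqs.map {R W X W' X' : Type*} [CommRing R] [Algebra ℝ R]
    [AddCommGroup W] [Module R W] [AddCommGroup X] [Module R X] [AddCommGroup W'] [Module R W']
    [AddCommGroup X'] [Module R X'] {wdg : W → W → X} {wdg' : W' → W' → X'} {ε : ℝ}
    {m n B C F : R} {ω : Fin 7 → W} {dω : Fin 7 → X}
    (h : ReducedStructureEqs wdg ε m n B C F ω dω) (f : W →ₗ[R] W') (T : X →ₗ[R] X')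
    (hT : ∀ α β, T (wdg α β) = wdg' (f α) (f β)) :
    ReducedStructureEqs wdg' ε m n B C F (fun i => f (ω i)) (fun i => T (dω i)) := by
  obtain ⟨h1, h2, h3, h4, h5, h6, h7⟩ := h
  constructor <;> simp only [h1, h2, h3, h4, h5, h6, h7, map_add, map_sub, map_neg, map_smul, hT]

variable {ω : Fin 7 → E → Covec}

/-- The covector with given components in a coframe. -/
def covecOfComponents (α : Fin 7 → Covec) : (Fin 7 → ℝ) →ₗ[ℝ] Covec where
  toFun c := ∑ i, c i • α i
  map_add' c d := by simp [add_smul, Finset.sum_add_distrib]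
  map_smul' r c := by simp [mul_smul, Finset.smul_sum]

/-- The bilinear function with given components in a coframe. -/
def bilinOfComponents (α : Fin 7 → Covec) : (Fin 7 → Fin 7 → ℝ) →ₗ[ℝ] (E → E → ℝ) where
  toFun c := fun v w => ∑ i, ∑ j, c i j * (α i v * α j w)
  map_add' c d := by
    ext v w
    simp [add_mul, Finset.sum_add_distrib]
  map_smul' r c := by
    ext v w
    simp [mul_assoc, Finset.mul_sum]

theorem bilinOfComponents_formalWedge (α : Fin 7 → Covec) (c d : Fin 7 → ℝ) :
    bilinOfComponents α (formalWedge c d) =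
      wedge (covecOfComponents α c) (covecOfComponents α d) := by
  ext v w
  simp only [bilinOfComponents, covecOfComponents, LinearMap.coe_mk, AddHom.coe_mk, formalWedge,
    wedge, sum_apply, smul_apply, smul_eq_mul, sub_mul,
    Finset.sum_sub_distrib, Finset.sum_mul_sum]
  congr 1
  · exact Finset.sum_congr rfl fun i _ => Finset.sum_congr rfl fun j _ => by ring
  · rw [Finset.sum_comm]
    exact Finset.sum_congr rfl fun i _ => Finset.sum_congr rfl fun j _ => by ring

theorem covecOfComponents_formalCoframe (α : Fin 7 → Covec) (i : Fin 7) :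
    covecOfComponents α (formalCoframe ℝ i) = α i := by
  simp [covecOfComponents, formalCoframe, Pi.single_apply]

theorem bilinOfComponents_structureCoeff (hV : IsOpen V) (hω : IsCoframeOn ω V) (hx : x ∈ V)
    (i : Fin 7) :
    bilinOfComponents (fun j => ω j x) (structureCoeff ω x i) = extD (ω i) x := by
  ext v w
  have hd := differentiableAt_of_contDiffOn hV (hω.1 i) hx
  have e : ∀ v w, fderiv ℝ (ω i) x v w = ∑ j, ∑ k,
      fderiv ℝ (ω i) x (dualFrame ω x j) (dualFrame ω x k) * (ω j x v * ω k x w) := by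
    intro v w
    conv_lhs => rw [eq_sum_dualFrame hω hx v, eq_sum_dualFrame hω hx w]
    simp only [map_sum, map_smul, sum_apply, smul_apply,
      smul_eq_mul, Finset.mul_sum]
    rw [Finset.sum_comm]
    exact Finset.sum_congr rfl fun j _ => Finset.sum_congr rfl fun k _ => by ring
  rw [extD_apply hd, e v w, e w v]
  simp only [bilinOfComponents, LinearMap.coe_mk, AddHom.coe_mk, structureCoeff_eq hV hω hx,
    sub_mul, Finset.sum_sub_distrib]
  congr 1
  rw [Finset.sum_comm]
  exact Finset.sum_congr rfl fun i _ => Finset.sum_congr rfl fun j _ => by ring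

/-- Structure equations hold for a coframe if they hold for its structure functions. -/
theorem reducedStructureEqs_wedge (hV : IsOpen V) (hω : IsCoframeOn ω V) (hx : x ∈ V) {ε : ℝ}
    {m n B C F : ℝ} (h : ReducedStructureEqs formalWedge ε m n B C F (formalCoframe ℝ)
      (structureCoeff ω x)) :
    ReducedStructureEqs wedge ε m n B C F (fun i => ω i x) (fun i => extD (ω i) x) := by
  have := h.map (wdg' := wedge) (covecOfComponents fun j => ω j x)
    (bilinOfComponents fun j => ω j x) (bilinOfComponents_formalWedge _)
  simpa only [covecOfComponents_formalCoframe, bilinOfComponents_structureCoeff hV hω hx] using this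

/-- If the structure functions of a coframe have the reduced form, then all the relations between
the coefficients follow. -/
theorem reducedOn_of_structureCoeff {ε : ℝ} (hε : ε = 1 ∨ ε = -1) (hV : IsOpen V)
    (hω : IsCoframeOn ω V) {m n B C F : E → ℝ} (hm : ContDiffOn ℝ (⊤ : ℕ∞) m V)
    (hn : ContDiffOn ℝ (⊤ : ℕ∞) n V) (hB : ContDiffOn ℝ (⊤ : ℕ∞) B V)
    (hC : ContDiffOn ℝ (⊤ : ℕ∞) C V) (hF : ContDiffOn ℝ (⊤ : ℕ∞) F V)
    (h : ∀ x ∈ V, ReducedStructureEqs formalWedge ε (m x) (n x) (B x) (C x) (F x)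
      (formalCoframe ℝ) (structureCoeff ω x)) :
    ReducedOn ε ω m n B V := by
  have hA : ReducedStructureEqs formalWedge ε (restrictSmooth m hm) (restrictSmooth n hn)
      (restrictSmooth B hB) (restrictSmooth C hC) (restrictSmooth F hF)
      (formalCoframe (smoothFunctions V)) (smoothStructureCoeff hV hω) :=
    reducedStructureEqs_smooth_iff.2 h
  obtain ⟨r1, r2, r3, r4, r5⟩ := (formal_integrability_conditions hε (frameDerivation hV hω) _
    _ _ _ _ _ hA (functionIntegrable_smoothFunctions hV hω _)
    (functionIntegrable_smoothFunctions hV hω _)).1 (coframeIntegrable_smoothFunctions hV hω)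
  have hfd : ∀ {g : E → ℝ} {x : E}, x ∈ V → ∀ {a b : ℝ},
      (∀ j, coframeDeriv ω j g x = a * formalCoframe ℝ 5 j + b * formalCoframe ℝ 7 j) →
      fderiv ℝ g x = a • ω 5 x + b • ω 7 x := by
    intro g x hx a b hg
    refine ContinuousLinearMap.coe_injective (ext_dualFrame hω hx fun j => ?_)
    have := hg j
    simp only [formalCoframe, Pi.single_apply] at this
    simp only [ContinuousLinearMap.coe_coe, add_apply,
      smul_apply, smul_eq_mul, coframe_dualFrame hω hx]
    simp only [eq_comm (a := (5 : Fin 7)), eq_comm (a := (7 : Fin 7))]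
    exact this
  have hcof : ∀ {x} (hx : x ∈ V) (i j : Fin 7),
      evalAt hx (formalCoframe (smoothFunctions V) i j) = formalCoframe ℝ i j := by
    intro x hx i j
    simp only [formalCoframe, Pi.single_apply]
    split_ifs <;> simp
  have hev : ∀ {x} (hx : x ∈ V) (g : E → ℝ) (hg : ContDiffOn ℝ (⊤ : ℕ∞) g V),
      evalAt hx (restrictSmooth g hg) = g x := fun _ _ _ => rfl
  have heps : ∀ {x} (hx : x ∈ V) (c : ℝ), evalAt hx (algebraMap ℝ (smoothFunctions V) c) = c :=
    fun _ _ => rfl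
  constructor
  · intro x hx
    have e4 := congrArg (evalAt hx) r4
    have e5 := congrArg (evalAt hx) r5
    simp only [gamma427, gamma635, frameDerivation_restrictSmooth, map_add, map_sub, map_mul,
      map_smul, hev, heps, smul_eq_mul] at e4 e5
    have := h x hx
    rw [e4, e5] at this
    exact reducedStructureEqs_wedge hV hω hx this
  · intro x hx
    refine hfd hx fun j => ?_
    have := congrArg (evalAt hx) (congrFun r1 j)
    simpa only [formalD0, frameDerivation_restrictSmooth, Pi.add_apply, Pi.smul_apply, smul_eq_mul,
      map_add, map_mul, hev, hcof] using this
  · intro x hx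
    refine hfd hx fun j => ?_
    have := congrArg (evalAt hx) (congrFun r2 j)
    simpa only [formalD0, frameDerivation_restrictSmooth, Pi.add_apply, Pi.smul_apply, smul_eq_mul,
      map_add, map_mul, hev, hcof] using this
  · intro x hx
    refine hfd hx fun j => ?_
    have := congrArg (evalAt hx) (congrFun r3 j)
    simp only [formalD0, frameDerivation_restrictSmooth, Pi.add_apply, Pi.smul_apply, smul_eq_mul,
      map_add, map_mul, hev, hcof, dBcoeff5, dBcoeff7, Delta1, map_sub, map_neg, map_smul, heps,
      map_ofNat] at this
    exact this

end Evaluation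

/-! ### Removing φ by a local rescaling -/

section Rescaling

variable {U V : Set E} {ω : Fin 7 → E → Covec} {x : E}

theorem eq_dualFrame (hω : IsCoframeOn ω V) (hx : x ∈ V) {v : E} {j : Fin 7}
    (h : ∀ i, ω i x v = if i = j then 1 else 0) : v = dualFrame ω x j := by
  refine (isInvertible_pi (hω.2 x hx)).injective ?_
  ext i
  simp [coframe_dualFrame hω hx, h]

theorem isCoframeOn_rescale (hω : IsCoframeOn ω V) {a : E → ℝ}
    (ha : ContDiffOn ℝ (⊤ : ℕ∞) a V) (hpos : ∀ x ∈ V, 0 < a x) :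
    IsCoframeOn (rescale a ω) V := by
  constructor
  · intro i
    have hw : 0 ≤ weight i := by revert i; decide
    have : rescale a ω i = fun x => (a x ^ (weight i).toNat) • ω i x := by
      ext1 x
      rw [rescale, ← zpow_natCast, Int.toNat_of_nonneg hw]
    rw [this]
    exact (ha.pow _).smul (hω.1 i)
  · intro x hx
    exact (hω.2 x hx).units_smul
      (fun i => Units.mk0 (a x ^ weight i) (zpow_pos (hpos x hx) _).ne')

theorem dualFrame_rescale (hω : IsCoframeOn ω V) {a : E → ℝ} (hx : x ∈ V)
    (ha : ContDiffOn ℝ (⊤ : ℕ∞) a V) (hpos : ∀ x ∈ V, 0 < a x) (j : Fin 7) :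
    dualFrame (rescale a ω) x j = a x ^ (-weight j) • dualFrame ω x j := by
  refine (eq_dualFrame (isCoframeOn_rescale hω ha hpos) hx fun i => ?_).symm
  simp only [rescale, smul_apply, map_smul, smul_eq_mul, coframe_dualFrame hω hx]
  split_ifs with h
  · rw [h, mul_one, ← zpow_add₀ (hpos x hx).ne']; simp
  · simp

theorem reducedTorsion_apply (T : Fin 7 → Fin 7 → Fin 7 → ℝ) (i j k : Fin 7) :
    T i j k = (weight i : ℝ) * (absorbingParameter T j * (if i = k then 1 else 0)
      - absorbingParameter T k * (if i = j then 1 else 0)) + reducedTorsion T i j k := by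
  simp only [reducedTorsion, Pi.sub_apply, absorption, mul_ite, mul_one, mul_zero]
  ring

/-- Rescaling by a function with `da/a = - ∑ λⱼ ωʲ`, where `λ` is the absorbing parameter,
leaves the remaining torsion as the only torsion. -/
theorem structureCoeff_rescale (hV : IsOpen V) (hω : IsCoframeOn ω V) {a : E → ℝ}
    (ha : ContDiffOn ℝ (⊤ : ℕ∞) a V) (hpos : ∀ x ∈ V, 0 < a x)
    (hda : ∀ x ∈ V, ∀ j, coframeDeriv ω j a x =
      -(a x * absorbingParameter (structureCoeff ω x) j)) (hx : x ∈ V)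
    (hw : ∀ i j k, weight i ≠ weight j + weight k →
      reducedTorsion (structureCoeff ω x) i j k = 0) :
    structureCoeff (rescale a ω) x = reducedTorsion (structureCoeff ω x) := by
  ext i j k
  have hax := (hpos x hx).ne'
  have had := differentiableAt_of_contDiffOn hV ha hx
  have hωd := differentiableAt_of_contDiffOn hV (hω.1 i) hx
  have hpd : HasFDerivAt (fun y => a y ^ weight i)
      (((weight i : ℝ) * a x ^ (weight i - 1)) • fderiv ℝ a x) x :=
    (hasDerivAt_zpow (weight i) (a x) (Or.inl hax)).comp_hasFDerivAt x had.hasFDerivAt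
  have hf : ∀ v w, fderiv ℝ (rescale a ω i) x v w = a x ^ weight i * fderiv ℝ (ω i) x v w +
      (weight i : ℝ) * a x ^ (weight i - 1) * fderiv ℝ a x v * ω i x w := by
    intro v w
    have := (hpd.smul hωd.hasFDerivAt).fderiv
    rw [show rescale a ω i = fun y => (a y ^ weight i) • ω i y from rfl,
      show fderiv ℝ (fun y => (a y ^ weight i) • ω i y) x = _ from this]
    simp
  have hs := structureCoeff_eq hV hω hx i j k
  rw [structureCoeff_eq hV (isCoframeOn_rescale hω ha hpos) hx, hf, hf,
    dualFrame_rescale hω hx ha hpos, dualFrame_rescale hω hx ha hpos]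
  simp only [map_smul, smul_apply, smul_eq_mul, coframe_dualFrame hω hx]
  have h1 := hda x hx j
  have h2 := hda x hx k
  simp only [coframeDeriv] at h1 h2
  rw [h1, h2]
  have h3 := reducedTorsion_apply (structureCoeff ω x) i j k
  have h4 : a x ^ (weight i - 1) * a x = a x ^ weight i := by
    rw [← zpow_add_one₀ hax]; simp
  -- Entries with wᵢ = wⱼ + wₖ are multiplied by a⁰ = 1 and the others are zero, so scaling fixes
  -- the remaining torsion.
  have h5 : reducedTorsion (structureCoeff ω x) i j k =
      a x ^ weight i * a x ^ (-weight j) * a x ^ (-weight k) *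
        reducedTorsion (structureCoeff ω x) i j k := by
    by_cases h : weight i = weight j + weight k
    · rw [← zpow_add₀ hax, ← zpow_add₀ hax, h,
        show weight j + weight k + -weight j + -weight k = 0 by ring, zpow_zero, one_mul]
    · rw [hw i j k h, mul_zero]
  rw [h5]
  rw [hs] at h3
  linear_combination a x ^ weight i * a x ^ (-weight j) * a x ^ (-weight k) * h3 +
    (weight i : ℝ) * a x ^ (-weight j) * a x ^ (-weight k) *
      (absorbingParameter (structureCoeff ω x) k * (if i = j then 1 else 0)
        - absorbingParameter (structureCoeff ω x) j * (if i = k then 1 else 0)) * h4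

/-- Local primitives of closed 1-forms, in terms of a coframe. -/
theorem exists_scaling_function (hU : IsOpen U) (hω : IsCoframeOn ω U) {φ : Fin 7 → E → ℝ}
    (hφ : ∀ k, ContDiffOn ℝ (⊤ : ℕ∞) (φ k) U)
    (hclosed : ∀ x ∈ U, ∀ j k, coframeDeriv ω j (φ k) x - coframeDeriv ω k (φ j) x
      + ∑ i, φ i x * structureCoeff ω x i j k = 0) {x₀ : E} (hx₀ : x₀ ∈ U) :
    ∃ V : Set E, IsOpen V ∧ x₀ ∈ V ∧ V ⊆ U ∧ ∃ a : E → ℝ, ContDiffOn ℝ (⊤ : ℕ∞) a V ∧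
      (∀ x ∈ V, 0 < a x) ∧ ∀ x ∈ V, ∀ j, coframeDeriv ω j a x = -(a x * φ j x) := by
  obtain ⟨r, hr, hball⟩ := Metric.isOpen_iff.1 hU x₀ hx₀
  let Φ : E → Covec := fun y => ∑ k, φ k y • ω k y
  have hΦ : ContDiffOn ℝ (⊤ : ℕ∞) Φ U := ContDiffOn.sum fun k _ => (hφ k).smul (hω.1 k)
  have hΦe : ∀ x ∈ U, ∀ j, Φ x (dualFrame ω x j) = φ j x := by
    intro x hx j
    simp [Φ, sum_apply, coframe_dualFrame hω hx]
  have hfd : ∀ x ∈ U, ∀ v w, fderiv ℝ Φ x v w =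
      ∑ k, (fderiv ℝ (φ k) x v * ω k x w + φ k x * fderiv ℝ (ω k) x v w) := by
    intro x hx v w
    have h : HasFDerivAt Φ _ x := HasFDerivAt.fun_sum fun k (_ : k ∈ Finset.univ) =>
      (differentiableAt_of_contDiffOn hU (hφ k) hx).hasFDerivAt.smul
        (differentiableAt_of_contDiffOn hU (hω.1 k) hx).hasFDerivAt
    rw [h.fderiv]
    simp [sum_apply, add_comm]
  have hsym : ∀ x ∈ U, ∀ v w, fderiv ℝ Φ x v w = fderiv ℝ Φ x w v := by
    intro x hx
    have hb : ∀ j k, fderiv ℝ Φ x (dualFrame ω x j) (dualFrame ω x k) =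
        fderiv ℝ Φ x (dualFrame ω x k) (dualFrame ω x j) := by
      intro j k
      have := hclosed x hx j k
      simp only [structureCoeff_eq hU hω hx, mul_sub, Finset.sum_sub_distrib] at this
      rw [hfd x hx, hfd x hx]
      simp only [coframe_dualFrame hω hx, Finset.sum_add_distrib, mul_ite, mul_one, mul_zero,
        Finset.sum_ite_eq', Finset.mem_univ, if_true]
      simp only [coframeDeriv] at this
      linear_combination this
    intro v w
    rw [eq_sum_dualFrame hω hx v, eq_sum_dualFrame hω hx w]
    simp only [map_sum, map_smul, sum_apply, smul_apply, smul_eq_mul, Finset.mul_sum]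
    rw [Finset.sum_comm]
    refine Finset.sum_congr rfl fun j _ => Finset.sum_congr rfl fun k _ => ?_
    rw [hb k j]; ring
  -- The Poincaré lemma on a ball: closedness of Φ is the symmetry of its derivative. With df = Φ,
  -- the function exp(-f) has logarithmic differential -Φ.
  obtain ⟨f, hf⟩ := (convex_ball x₀ r).exists_forall_hasFDerivAt_of_fderiv_symmetric
    Metric.isOpen_ball ((hΦ.mono hball).differentiableOn (by simp))
    fun y hy => hsym y (hball hy)
  have hfs : ContDiffOn ℝ (⊤ : ℕ∞) f (Metric.ball x₀ r) := by
    rw [contDiffOn_infty_iff_fderiv_of_isOpen Metric.isOpen_ball]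
    exact ⟨fun y hy => (hf y hy).differentiableAt.differentiableWithinAt,
      (hΦ.mono hball).congr fun y hy => (hf y hy).fderiv⟩
  refine ⟨Metric.ball x₀ r, Metric.isOpen_ball, Metric.mem_ball_self hr, hball,
    fun y => Real.exp (-f y), hfs.neg.exp, fun y _ => Real.exp_pos _, fun y hy j => ?_⟩
  have := (hf y hy).neg.exp.fderiv
  rw [coframeDeriv, show fderiv ℝ (fun y => Real.exp (-f y)) y = _ from this]
  simp [hΦe y (hball hy)]

end Rescaling

/-! ### The normal form -/

section NormalForm

variable {U : Set E} {ω : Fin 7 → E → Covec} {ε : ℝ}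

theorem contDiffOn_torsion (hU : IsOpen U) (hω : IsCoframeOn ω U)
    (κ : (Fin 7 → Fin 7 → Fin 7 → ℝ) →ₗ[ℝ] ℝ) :
    ContDiffOn ℝ (⊤ : ℕ∞) (fun x => κ (structureCoeff ω x)) U := by
  refine (LinearMap.toContinuousLinearMap κ).contDiff.comp_contDiffOn ?_
  exact contDiffOn_pi.2 fun i => contDiffOn_pi.2 fun j => contDiffOn_pi.2 fun k =>
    contDiffOn_structureCoeff hU hω i j k

theorem contDiffOn_absorbingParameter (hU : IsOpen U) (hω : IsCoframeOn ω U) (j : Fin 7) :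
    ContDiffOn ℝ (⊤ : ℕ∞) (fun x => absorbingParameter (structureCoeff ω x) j) U := by
  simp only [absorbingParameter]
  split_ifs
  · exact contDiffOn_structureCoeff hU hω _ _ _
  · exact contDiffOn_const.mul (contDiffOn_structureCoeff hU hω _ _ _)

theorem exists_normal_form (hε : ε = 1 ∨ ε = -1) (hU : IsOpen U) (hω : IsCoframeOn ω U)
    (hg : GenericHyperbolicOn ε ω U) (h1 : NontrivialTorsionConstant ω U)
    (h2 : ¬ ReducibleToIdentity ω U) :
    ∃ m n B : E → ℝ,
      ContDiffOn ℝ (⊤ : ℕ∞) m U ∧ ContDiffOn ℝ (⊤ : ℕ∞) n U ∧ ContDiffOn ℝ (⊤ : ℕ∞) B U ∧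
      ∀ x₀ ∈ U, ∃ V : Set E, IsOpen V ∧ x₀ ∈ V ∧ V ⊆ U ∧
        ∃ a : E → ℝ, ContDiffOn ℝ (⊤ : ℕ∞) a V ∧ (∀ x ∈ V, 0 < a x) ∧
          ReducedOn ε (rescale a ω) m n B V := by
  let R : Fin 7 → Fin 7 → Fin 7 → E → ℝ := fun i j k x => reducedTorsion (structureCoeff ω x) i j k
  have hR : ∀ i j k, ContDiffOn ℝ (⊤ : ℕ∞) (R i j k) U := fun i j k =>
    contDiffOn_torsion hU hω (torsionComponent i j k)
  have hφ := contDiffOn_absorbingParameter hU hω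
  have hw : ∀ x ∈ U, ∀ i j k, weight i ≠ weight j + weight k →
      reducedTorsion (structureCoeff ω x) i j k = 0 := fun x hx => reducedTorsion_eq_zero h1 h2 hx
  let RA : Fin 7 → Fin 7 → Fin 7 → smoothFunctions U := fun i j k =>
    restrictSmooth (R i j k) (hR i j k)
  let φA : Fin 7 → smoothFunctions U := fun j => restrictSmooth _ (hφ j)
  have hT : RA = coeffTable (algebraMap ℝ (smoothFunctions U) ε) (RA 5 5 7) (RA 7 5 7) (RA 2 2 5)
      (RA 2 2 7) (RA 3 3 5) (RA 3 3 7) (RA 4 4 5) (RA 4 4 7) (RA 6 6 5) (RA 6 6 7) (RA 4 2 5)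
      (RA 4 2 7) (RA 6 3 5) (RA 6 3 7) := by
    ext i j k : 3
    refine smoothFunctions_ext fun x hx => ?_
    change R i j k x = (evalAt hx : smoothFunctions U →+* ℝ) _
    rw [coeffTable_map]
    exact congrFun (congrFun (congrFun
      (reducedTorsion_eq_coeffTable hU hω hg hx rfl (hw x hx)) i) j) k
  obtain ⟨hred, hclosed⟩ := reducedStructureEqs_of_twist (frameDerivation hU hω)
    (γ := smoothStructureCoeff hU hω) (R := RA) (φ := φA) hε
    (fun i j k => smoothFunctions_ext fun x hx => by
      have := reducedTorsion_apply (structureCoeff ω x) i j k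
      change structureCoeff ω x i j k = evalAt hx ((weight i : smoothFunctions U) *
        (φA j * (if i = k then 1 else 0) - φA k * (if i = j then 1 else 0)) + RA i j k)
      simp only [map_add, map_mul, map_sub, map_intCast, apply_ite (evalAt hx), map_one, map_zero]
      exact this)
    (fun i j k h => smoothFunctions_ext fun x hx => hw x hx i j k h) hT
    (coframeIntegrable_smoothFunctions hU hω)
  -- m, n, B are entries of the remaining torsion of the original coframe, fixed before the
  -- neighbourhood and a are chosen.
  refine ⟨R 5 5 7, R 7 5 7, R 4 2 5, hR _ _ _, hR _ _ _, hR _ _ _, fun x₀ hx₀ => ?_⟩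
  obtain ⟨V, hV, hxV, hVU, a, ha, hpos, hda⟩ := exists_scaling_function hU hω hφ
    (fun x hx j k => by
      have := congrArg (evalAt hx) (hclosed j k)
      simp only [formalD1, φA, frameDerivation_restrictSmooth, map_add, map_sub, map_sum, map_mul,
        map_zero] at this
      exact this) hx₀
  have hωV : IsCoframeOn ω V := ⟨fun i => (hω.1 i).mono hVU, fun x hx => hω.2 x (hVU hx)⟩
  refine ⟨V, hV, hxV, hVU, a, ha, hpos, reducedOn_of_structureCoeff hε hV
    (isCoframeOn_rescale hωV ha hpos) ((hR _ _ _).mono hVU) ((hR _ _ _).mono hVU)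
    ((hR _ _ _).mono hVU) ((hR 4 2 7).mono hVU) ((hR 6 3 5).mono hVU) fun x hx => ?_⟩
  rw [structureCoeff_rescale hV hωV ha hpos hda hx (hw x (hVU hx))]
  exact reducedStructureEqs_smooth_iff.1 hred x (hVU hx)

end NormalForm

end GenericHyperbolic

theorem mainTheorem9 (ε : ℝ) (hε : ε = 1 ∨ ε = -1) :
    -- the normal form of the structure equations
    (∀ (U : Set GenericHyperbolic.E) (ω : Fin 7 → GenericHyperbolic.E → GenericHyperbolic.Covec),
      IsOpen U →
      GenericHyperbolic.IsCoframeOn ω U →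
      GenericHyperbolic.GenericHyperbolicOn ε ω U →
      GenericHyperbolic.NontrivialTorsionConstant ω U →
      ¬ GenericHyperbolic.ReducibleToIdentity ω U →
      ∃ m n B : GenericHyperbolic.E → ℝ,
        ContDiffOn ℝ (⊤ : ℕ∞) m U ∧ ContDiffOn ℝ (⊤ : ℕ∞) n U ∧ ContDiffOn ℝ (⊤ : ℕ∞) B U ∧
        ∀ x₀ ∈ U, ∃ V : Set GenericHyperbolic.E, IsOpen V ∧ x₀ ∈ V ∧ V ⊆ U ∧
          ∃ a : GenericHyperbolic.E → ℝ, ContDiffOn ℝ (⊤ : ℕ∞) a V ∧ (∀ x ∈ V, 0 < a x) ∧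
            GenericHyperbolic.ReducedOn ε (GenericHyperbolic.rescale a ω) m n B V) ∧
    -- the integrability conditions
    (∀ (A : Type) [CommRing A] [Algebra ℝ A] (D : Fin 7 → Derivation ℝ A A)
      (γ : Fin 7 → Fin 7 → Fin 7 → A) (m n B g427 g635 : A),
      GenericHyperbolic.ReducedStructureEqs GenericHyperbolic.formalWedge ε m n B g427 g635
        (GenericHyperbolic.formalCoframe A) γ →
      -- modulo `d²m = d²n = 0`, the conditions `d²ωⁱ = 0` amount to the formulas for
      -- `dm`, `dn`, `dB` and the two coefficients
      (GenericHyperbolic.FunctionIntegrable D γ m → GenericHyperbolic.FunctionIntegrable D γ n →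
        (GenericHyperbolic.CoframeIntegrable D γ ↔
          GenericHyperbolic.FormalRelations D ε m n B g427 g635)) ∧
      -- given these formulas, all integrability conditions together
      -- reduce to those for `dm`, `dn`, `dB`
      (GenericHyperbolic.FormalRelations D ε m n B g427 g635 →
        ((GenericHyperbolic.CoframeIntegrable D γ ∧ GenericHyperbolic.FunctionIntegrable D γ m ∧
            GenericHyperbolic.FunctionIntegrable D γ n ∧
            GenericHyperbolic.FunctionIntegrable D γ B) ↔
          (GenericHyperbolic.FunctionIntegrable D γ m ∧
            GenericHyperbolic.FunctionIntegrable D γ n ∧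
            GenericHyperbolic.FunctionIntegrable D γ B)))) := by
  refine ⟨fun U ω hU hω hg h1 h2 => GenericHyperbolic.exists_normal_form hε hU hω hg h1 h2,
    fun A _ _ D γ m n B g427 g635 h => ?_⟩
  have key := GenericHyperbolic.formal_integrability_conditions hε D γ m n B g427 g635 h
  -- The second formal claim needs nothing new: given the formulas, d²m = d²n = 0 already implies
  -- d²ωⁱ = 0 by the first.
  exact ⟨key, fun hr => ⟨fun hi => hi.2, fun hi => ⟨(key hi.1 hi.2.1).2 hr, hi⟩⟩⟩
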